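/- Let $M$ be a smooth manifold of dimension $m = k+2r$ ($k, r \ge 0$), and let $\alpha_1,\dots,\alpha_k$ be smooth 1-forms on $M$, linearly independent at every point, satisfying $d\alpha_i\wedge\mu = 0$ for $i=1,\dots,k$, where $\mu=\alpha_1\wedge\cdots\wedge\alpha_k$. Let $\mathcal F$ be the foliation with tangent distribution $\bigcap_i\ker\alpha_i$. Let $\omega$ be a smooth 2-form compatible with $\mathcal F$, that is, $d\omega\wedge\mu=0$ and $\Omega_\omega=\mu\wedge\omega^r$ is a volume form (nowhere zero). Let $X^1,\dots,X^k$ be smooth vector fields on $M$ dual to the $\alpha_i$, $\alpha_i(X^j)=\delta_{ij}$, with $i_{X^j}\omega=0$ for all $j$. Let $\Pi$ be the bivector field defined by $$ i_\Pi\Omega_\omega = r\,\mu\wedge\omega^{r-1} $$ (right-hand side $0$ if $r=0$), where $i_{X\wedge Y}\Omega=\Omega(X,Y,\cdot,\dots,\cdot)$. Let $\Pi^\sharp:T^*M\to TM$ be given by $\beta(\Pi^\sharp\eta)=\Pi(\eta,\beta)$, and put $X_f=\Pi^\sharp(df)$. Suppose that, for every $j=1,\dots,k$, a) $i_{X_f}L_{X^j}\mu=0$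 for all $f\in C^\infty(M)$, and b) $(i_{X^j}\mu)\wedge d\omega=0$. Then $\Pi$ is a regular Poisson tensor ($[\Pi,\Pi]=0$ and $\Pi$ has constant rank) with characteristic foliation $\mathcal F$, i.e. $\Pi^\sharp(T^*_xM)=\bigcap_i\ker\alpha_i(x)$ for all $x$; each $X^j$ is a Poisson vector field, $[\Pi,X^j]=0$; and $\Pi$ is transversally constant: there is a smooth distribution $T$ on $M$ complementary to the tangent distribution of $\mathcal F$ such that every smooth vector field $X$ on an open set of $M$ which takes values in $T$ and preserves $\mathcal F$ (that is, $[X,Y]$ is tangent to $\mathcal F$ for every local vector field $Y$ tangent to $\mathcal F$) is a Poisson vector field there. -/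

import Mathlib

open scoped ContDiff Manifold

noncomputable section

namespace FoliatedPoisson

/-! ### Exterior algebra of a finite-dimensional vector space -/

section Linear

variable {E : Type*} [AddCommGroup E] [Module ℝ E] [TopologicalSpace E]

/-- The wedge product of alternating forms: the signed sum over `(p,q)`-shuffles of the products
`f (v_σ(1), …, v_σ(p)) * g (v_σ(p+1), …, v_σ(p+q))`. -/
def wedge {p q : ℕ} (f : E [⋀^Fin p]→L[ℝ] ℝ) (g : E [⋀^Fin q]→L[ℝ] ℝ) :
    E [⋀^Fin (p + q)]→L[ℝ] ℝ :=
  { ((LinearMap.mul' ℝ ℝ).compAlternatingMap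
      (f.toAlternatingMap.domCoprod g.toAlternatingMap)).domDomCongr finSumFinEquiv with
    cont := by
      change Continuous fun v : Fin (p + q) → E =>
        LinearMap.mul' ℝ ℝ ((f.toAlternatingMap.domCoprod g.toAlternatingMap)
          (v ∘ finSumFinEquiv))
      simp only [AlternatingMap.domCoprod_apply, sum_apply, map_sum]
      refine continuous_finsetSum _ fun σ _ => ?_
      induction σ using Quotient.inductionOn' with
      | h σ =>
        rw [AlternatingMap.domCoprod.summand_mk'']
        rcases Int.units_eq_one_or (Equiv.Perm.sign σ) with h | h <;> simp [h] <;> fun_prop }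

/-- The wedge product `α₁ ∧ ⋯ ∧ α_k` of a family of 1-forms (equal to `1` if `k = 0`). -/
def wedgeFamily : (k : ℕ) → (Fin k → E [⋀^Fin 1]→L[ℝ] ℝ) → E [⋀^Fin k]→L[ℝ] ℝ
  | 0, _ => ContinuousAlternatingMap.constOfIsEmpty ℝ E (Fin 0) 1
  | k + 1, α => wedge (wedgeFamily k fun i => α i.castSucc) (α (Fin.last k))

/-- The wedge power `ϖ^r = ϖ ∧ ⋯ ∧ ϖ` of a 2-form (equal to `1` if `r = 0`). -/
def wedgePow (ϖ : E [⋀^Fin 2]→L[ℝ] ℝ) : (r : ℕ) → E [⋀^Fin (2 * r)]→L[ℝ] ℝ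
  | 0 => ContinuousAlternatingMap.constOfIsEmpty ℝ E (Fin 0) 1
  | r + 1 => wedge (wedgePow ϖ r) ϖ

/-- The interior product `i_X f = f (X, ·, …, ·)`, which is `0` on 0-forms. -/
def interior (X : E) : {n : ℕ} → E [⋀^Fin n]→L[ℝ] ℝ → E [⋀^Fin (n - 1)]→L[ℝ] ℝ
  | 0, _ => 0
  | _ + 1, f =>
    { f.toAlternatingMap.curryLeft X with
      cont := by
        change Continuous fun v => f (Matrix.vecCons X v)
        fun_prop }

variable [IsTopologicalAddGroup E] [ContinuousSMul ℝ E] [T2Space E] [FiniteDimensional ℝ E]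

/-- The `i`-th covector of the basis dual to `Module.finBasis ℝ E`. -/
def coframe (E : Type*) [AddCommGroup E] [Module ℝ E] [TopologicalSpace E]
    [IsTopologicalAddGroup E] [ContinuousSMul ℝ E] [T2Space E] [FiniteDimensional ℝ E]
    (i : Fin (Module.finrank ℝ E)) : E →L[ℝ] ℝ :=
  LinearMap.toContinuousLinearMap ((Module.finBasis ℝ E).coord i)

/-- The map `P^♯ : E^* → E` of a bivector `P`, determined by `β (P^♯ η) = P (η, β)`
(see `apply_sharp`). -/
def sharp (P : (E →L[ℝ] ℝ) [⋀^Fin 2]→L[ℝ] ℝ) : (E →L[ℝ] ℝ) →ₗ[ℝ] E where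
  toFun η := ∑ i, P ![η, coframe E i] • Module.finBasis ℝ E i
  map_add' η η' := by
    simp only [ContinuousAlternatingMap.vecCons_add, add_smul, Finset.sum_add_distrib]
  map_smul' c η := by
    simp only [ContinuousAlternatingMap.vecCons_smul, smul_assoc, Finset.smul_sum,
      RingHom.id_apply]

/-- The contraction `i_P Ω` of a form with a bivector: for `P = ½ ∑ Pⁱʲ e_i ∧ e_j` it is
`½ ∑ Pⁱʲ Ω(e_i, e_j, ·, …, ·)`, so that `i_{X ∧ Y} Ω = Ω(X, Y, ·, …, ·)`. -/
def contract (P : (E →L[ℝ] ℝ) [⋀^Fin 2]→L[ℝ] ℝ) {n : ℕ} (Ω : E [⋀^Fin n]→L[ℝ] ℝ) :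
    E [⋀^Fin (n - 1 - 1)]→L[ℝ] ℝ :=
  (2⁻¹ : ℝ) • ∑ i, ∑ j, P ![coframe E i, coframe E j] •
    interior (Module.finBasis ℝ E j) (interior (Module.finBasis ℝ E i) Ω)

theorem apply_sharp (P : (E →L[ℝ] ℝ) [⋀^Fin 2]→L[ℝ] ℝ) (η β : E →L[ℝ] ℝ) :
    β (sharp P η) = P ![η, β] := by
  have hβ : β = ∑ i, β (Module.finBasis ℝ E i) • coframe E i := by
    ext v
    have hv := congrArg β ((Module.finBasis ℝ E).sum_repr v)
    rw [map_sum] at hv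
    rw [← hv, sum_apply]
    refine Finset.sum_congr rfl fun i _ => ?_
    simp [coframe, mul_comm]
  have hlin : ∀ f : Fin (Module.finrank ℝ E) → ℝ,
      P ![η, ∑ i, f i • coframe E i] = ∑ i, f i * P ![η, coframe E i] := by
    intro f
    have := map_sum (P.toAlternatingMap.curryLeft η |>.toMultilinearMap.toLinearMap ![0] 0)
      (fun i => f i • coframe E i) Finset.univ
    have key : ∀ b, (P.toAlternatingMap.curryLeft η |>.toMultilinearMap.toLinearMap ![0] 0) b
        = P ![η, b] := by
      intro b
      have hb : Function.update ![(0 : E →L[ℝ] ℝ)] 0 b = ![b] := by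
        ext i; fin_cases i; simp
      simp only [MultilinearMap.toLinearMap_apply, hb]
      rfl
    rw [← key, this]
    refine Finset.sum_congr rfl fun i _ => ?_
    rw [map_smul, key, smul_eq_mul]
  conv_rhs => rw [hβ, hlin]
  simp [sharp, map_sum, mul_comm]

end Linear

/-! ### Schouten brackets on a vector space -/

section SchoutenLinear

variable {E : Type*} [NormedAddCommGroup E] [NormedSpace ℝ E]

/-- The Schouten bracket `[X, P] = L_X P` of a vector field and a bivector field on a vector space,
evaluated at the point `y` on two constant covectors:
`X(P(a,b)) - P(L_X a, b) - P(a, L_X b)`, where `L_X a = a ∘ DX`. -/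
def schoutenVec (X : E → E) (P : E → (E →L[ℝ] ℝ) [⋀^Fin 2]→L[ℝ] ℝ) (y : E)
    (a b : E →L[ℝ] ℝ) : ℝ :=
  fderiv ℝ (fun z => P z ![a, b]) y (X y)
    - P y ![a ∘L fderiv ℝ X y, b] - P y ![a, b ∘L fderiv ℝ X y]

/-- The Schouten bracket `[P, P]` of a bivector field on a vector space with itself, evaluated at
the point `y` on three constant covectors; in coordinates, its `(i,j,k)` component is
`2 ∑_l (Pⁱˡ ∂_l Pʲᵏ + Pʲˡ ∂_l Pᵏⁱ + Pᵏˡ ∂_l Pⁱʲ)`. -/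
def schoutenSelf [FiniteDimensional ℝ E] (P : E → (E →L[ℝ] ℝ) [⋀^Fin 2]→L[ℝ] ℝ) (y : E)
    (a b c : E →L[ℝ] ℝ) : ℝ :=
  2 * (fderiv ℝ (fun z => P z ![b, c]) y (sharp (P y) a)
    + fderiv ℝ (fun z => P z ![c, a]) y (sharp (P y) b)
    + fderiv ℝ (fun z => P z ![a, b]) y (sharp (P y) c))

end SchoutenLinear

/-! ### Tensor fields on a manifold -/

section Manifold

variable {m : ℕ} {M : Type*} [TopologicalSpace M] [ChartedSpace (EuclideanSpace ℝ (Fin m)) M]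
  [IsManifold (𝓡 m) ∞ M]

instance instFiniteDimensionalTangentSpace (x : M) :
    FiniteDimensional ℝ (TangentSpace (𝓡 m) x) :=
  inferInstanceAs (FiniteDimensional ℝ (EuclideanSpace ℝ (Fin m)))

instance instT2SpaceTangentSpace (x : M) : T2Space (TangentSpace (𝓡 m) x) :=
  inferInstanceAs (T2Space (EuclideanSpace ℝ (Fin m)))

variable (m M) in
/-- Vector fields, not necessarily smooth. -/
abbrev VField : Type _ := (x : M) → TangentSpace (𝓡 m) x

variable (m M) in
/-- Differential forms of degree `n`, not necessarily smooth. -/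
abbrev Form (n : ℕ) : Type _ := (x : M) → TangentSpace (𝓡 m) x [⋀^Fin n]→L[ℝ] ℝ

variable (m M) in
/-- Contravariant antisymmetric 2-tensor fields, not necessarily smooth. -/
abbrev Bivector : Type _ :=
  (x : M) → (TangentSpace (𝓡 m) x →L[ℝ] ℝ) [⋀^Fin 2]→L[ℝ] ℝ

/-- The coordinate expression of a vector field in the preferred chart at `x₀`. -/
def VField.inChart (X : VField m M) (x₀ : M) : EuclideanSpace ℝ (Fin m) → EuclideanSpace ℝ (Fin m) :=
  VectorField.mpullback 𝓘(ℝ, EuclideanSpace ℝ (Fin m)) (𝓡 m) (extChartAt (𝓡 m) x₀).symm X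

/-- The coordinate expression of a differential form in the preferred chart at `x₀`: its pullback
under the inverse of the chart. -/
def Form.inChart {n : ℕ} (ϖ : Form m M n) (x₀ : M) :
    EuclideanSpace ℝ (Fin m) → EuclideanSpace ℝ (Fin m) [⋀^Fin n]→L[ℝ] ℝ := fun y =>
  (ϖ ((extChartAt (𝓡 m) x₀).symm y)).compContinuousLinearMap
    (mfderiv 𝓘(ℝ, EuclideanSpace ℝ (Fin m)) (𝓡 m) (extChartAt (𝓡 m) x₀).symm y)

/-- The coordinate expression of a bivector field in the preferred chart `φ` at `x₀`: its
push-forward under `φ`, whose value on covectors `a, b` is `Π (a ∘ dφ, b ∘ dφ)`. -/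
def Bivector.inChart (P : Bivector m M) (x₀ : M) : EuclideanSpace ℝ (Fin m) →
    (EuclideanSpace ℝ (Fin m) →L[ℝ] ℝ) [⋀^Fin 2]→L[ℝ] ℝ := fun y =>
  (P ((extChartAt (𝓡 m) x₀).symm y)).compContinuousLinearMap
    (ContinuousLinearMap.precomp ℝ
      (mfderiv (𝓡 m) 𝓘(ℝ, EuclideanSpace ℝ (Fin m)) (extChartAt (𝓡 m) x₀)
        ((extChartAt (𝓡 m) x₀).symm y)))

/-- A vector field is smooth on a set. -/
def VField.SmoothOn (X : VField m M) (U : Set M) : Prop :=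
  ContMDiffOn (𝓡 m) (𝓡 m).tangent ∞ (fun x => (⟨x, X x⟩ : TangentBundle (𝓡 m) M)) U

/-- A differential form is smooth: its coefficients are smooth in every chart of the atlas
of preferred charts. -/
def Form.Smooth {n : ℕ} (ϖ : Form m M n) : Prop :=
  ∀ x₀ : M, ContDiffOn ℝ ∞ (ϖ.inChart x₀) (extChartAt (𝓡 m) x₀).target

/-- A bivector field is smooth: its coefficients are smooth in every chart of the atlas
of preferred charts. -/
def Bivector.Smooth (P : Bivector m M) : Prop :=
  ∀ x₀ : M, ContDiffOn ℝ ∞ (P.inChart x₀) (extChartAt (𝓡 m) x₀).target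

/-- The exterior derivative of a differential form, computed at each point `x` in the preferred
chart at `x`. -/
def Form.d {n : ℕ} (ϖ : Form m M n) : Form m M (n + 1) := fun x =>
  (extDeriv (ϖ.inChart x) (extChartAt (𝓡 m) x x)).compContinuousLinearMap
    (mfderiv (𝓡 m) 𝓘(ℝ, EuclideanSpace ℝ (Fin m)) (extChartAt (𝓡 m) x) x)

/-- The interior product of a differential form of positive degree with a vector field. -/
def Form.iprod {n : ℕ} (X : VField m M) (ϖ : Form m M (n + 1)) : Form m M n := fun x =>
  interior (X x) (ϖ x)

/-- The Lie derivative of a differential form, `L_X ϖ = d (i_X ϖ) + i_X (d ϖ)`, where `i_X ϖ = 0`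
if `ϖ` has degree `0`. -/
def Form.lieDeriv (X : VField m M) : {n : ℕ} → Form m M n → Form m M n
  | 0, ϖ => fun x => Form.iprod X (Form.d ϖ) x
  | _ + 1, ϖ => fun x => Form.d (Form.iprod X ϖ) x + Form.iprod X (Form.d ϖ) x

/-- The Hamiltonian vector field `X_f = Π^♯(df)`. -/
def Bivector.hamiltonian (P : Bivector m M) (f : M → ℝ) : VField m M := fun x =>
  sharp (P x) (mfderiv (𝓡 m) 𝓘(ℝ, ℝ) f x)

/-- The characteristic distribution of a bivector field, with fibres `Π^♯(T^*_x M)`; it is the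
tangent distribution of the characteristic foliation if `Π` is a regular Poisson tensor. -/
def Bivector.charDist (P : Bivector m M) (x : M) : Submodule ℝ (TangentSpace (𝓡 m) x) :=
  LinearMap.range (sharp (P x))

/-- A regular Poisson tensor: a smooth bivector field of constant rank with `[Π, Π] = 0` (the
bracket being computed at each point `x` in the preferred chart at `x`). -/
structure Bivector.IsRegularPoisson (P : Bivector m M) : Prop where
  smooth : P.Smooth
  jacobi : ∀ (x : M) (a b c : EuclideanSpace ℝ (Fin m) →L[ℝ] ℝ),
    schoutenSelf (P.inChart x) (extChartAt (𝓡 m) x x) a b c = 0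
  rank_const : ∃ d : ℕ, ∀ x : M, Module.finrank ℝ (P.charDist x) = d

/-- `X` is a Poisson vector field on `U`: it satisfies `[Π, X] = 0` there (the bracket being
computed at each point `x` in the preferred chart at `x`). -/
def Bivector.IsPoissonVFieldOn (P : Bivector m M) (X : VField m M) (U : Set M) : Prop :=
  ∀ x ∈ U, ∀ a b : EuclideanSpace ℝ (Fin m) →L[ℝ] ℝ,
    schoutenVec (X.inChart x) (P.inChart x) (extChartAt (𝓡 m) x x) a b = 0

/-- The vector field `X` on `U` preserves the foliation with tangent distribution `D`: its bracket
with every local vector field tangent to `D` is again tangent to `D`. -/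
def PreservesOn (D : (x : M) → Submodule ℝ (TangentSpace (𝓡 m) x)) (X : VField m M)
    (U : Set M) : Prop :=
  ∀ (W : Set M) (Y : VField m M), IsOpen W → W ⊆ U → Y.SmoothOn W → (∀ x ∈ W, Y x ∈ D x) →
    ∀ x ∈ W, VectorField.mlieBracket (𝓡 m) X Y x ∈ D x

/-- `T` is a smooth distribution: around every point it is spanned by finitely many smooth local
vector fields. -/
def IsSmoothDist (T : (x : M) → Submodule ℝ (TangentSpace (𝓡 m) x)) : Prop :=
  ∀ x₀ : M, ∃ (U : Set M) (n : ℕ) (Z : Fin n → VField m M), IsOpen U ∧ x₀ ∈ U ∧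
    (∀ i, VField.SmoothOn (Z i) U) ∧ ∀ x ∈ U, Submodule.span ℝ (Set.range fun i => Z i x) = T x

/-- `Π` is transversally constant: it is a regular Poisson tensor, and its characteristic foliation
has a transversal distribution `T` such that every local vector field in `T` which preserves the
characteristic foliation is a Poisson vector field. -/
def Bivector.IsTransversallyConstant (P : Bivector m M) : Prop :=
  P.IsRegularPoisson ∧ ∃ T : (x : M) → Submodule ℝ (TangentSpace (𝓡 m) x),
    IsSmoothDist T ∧ (∀ x, IsCompl (T x) (P.charDist x)) ∧
    ∀ (U : Set M) (X : VField m M), IsOpen U → X.SmoothOn U → (∀ x ∈ U, X x ∈ T x) →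
      PreservesOn P.charDist X U → P.IsPoissonVFieldOn X U

/-! ### Foliations generated by 1-forms and compatible 2-forms -/

/-- The `k`-form `μ = α₁ ∧ ⋯ ∧ α_k`. -/
def muForm {k : ℕ} (α : Fin k → Form m M 1) : Form m M k := fun x =>
  wedgeFamily k fun i => α i x

/-- The 1-forms `α₁, …, α_k` are generators of a foliation: they are smooth, pointwise linearly
independent, and satisfy the integrability conditions `dα_i ∧ μ = 0`. -/
structure IsGenerators {k : ℕ} (α : Fin k → Form m M 1) : Prop where
  smooth : ∀ i, Form.Smooth (α i)
  indep : ∀ x, LinearIndependent ℝ fun i => α i x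
  integrable : ∀ i x, wedge (Form.d (α i) x) (muForm α x) = 0

/-- The tangent distribution `⋂ ker α_i` of the foliation generated by the `α_i`. -/
def tangentDist {k : ℕ} (α : Fin k → Form m M 1) (x : M) :
    Submodule ℝ (TangentSpace (𝓡 m) x) where
  carrier := {v | ∀ i, α i x ![v] = 0}
  zero_mem' i := by
    simpa using (α i x).map_coord_zero (m := ![0]) 0 rfl
  add_mem' {v w} hv hw i := by
    rw [ContinuousAlternatingMap.vecCons_add, hv i, hw i, add_zero]
  smul_mem' c v hv i := by
    rw [ContinuousAlternatingMap.vecCons_smul, hv i, smul_zero]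

/-- The form `Ω_ϖ = μ ∧ ϖ^r`. -/
def volForm {k : ℕ} (r : ℕ) (α : Fin k → Form m M 1) (ϖ : Form m M 2) : Form m M (k + 2 * r) :=
  fun x => wedge (muForm α x) (wedgePow (ϖ x) r)

/-- The form `r μ ∧ ϖ^(r-1)`, which is `0` for `r = 0`. -/
def sigmaForm {k : ℕ} : (r : ℕ) → (Fin k → Form m M 1) → Form m M 2 →
    Form m M (k + 2 * r - 1 - 1)
  | 0, _, _ => fun _ => 0
  | r + 1, α, ϖ => fun x => ((r + 1 : ℕ) : ℝ) • wedge (muForm α x) (wedgePow (ϖ x) r)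

/-- The 2-form `ϖ` is compatible with the foliation of codimension `k` generated by the `α_i` on a
manifold of dimension `m = k + 2r`: it is smooth, `dϖ ∧ μ = 0`, and `μ ∧ ϖ^r` is a volume form. -/
structure IsCompatible {k : ℕ} (r : ℕ) (α : Fin k → Form m M 1) (ϖ : Form m M 2) : Prop where
  smooth : ϖ.Smooth
  closed : ∀ x, wedge (ϖ.d x) (muForm α x) = 0
  dim_eq : m = k + 2 * r
  volume : ∀ x, volForm r α ϖ x ≠ 0

/-- The vector fields `X^j` are smooth and dual to the `α_i`: `α_i(X^j) = δ_ij`. -/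
structure IsDual {k : ℕ} (α : Fin k → Form m M 1) (X : Fin k → VField m M) : Prop where
  smooth : ∀ j, VField.SmoothOn (X j) Set.univ
  apply_eq : ∀ i j x, α i x ![X j x] = if i = j then 1 else 0

end Manifold

end FoliatedPoisson

end

/-!
The forms `α_i` cut out a distribution `D = ⋂ ker α_i`, and everything rests on one pointwise
statement: the equation `i_Π Ω = r μ ∧ ϖ^(r-1)` says that `Π^♯` takes values in `D` and that
`ϖ (Z, Π^♯ b) = b Z` for all `Z` in `D` (`IsInverseOn`). In other words `Π` is, along the leaves,
the inverse of the leafwise symplectic form `ϖ`. To see this, contract `b ∧ Ω = 0` with `Π`: the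
result is `i_{Π^♯ b} Ω = - b ∧ i_Π Ω`, so that the volume form `Ω` determines `Π^♯ b`
(`ctr_sharp_volume`). For `b = α_i` the right-hand side vanishes; for `b = i_Z ϖ` with `Z` in `D` it
is `- i_Z Ω`, because contraction with `Z` is an antiderivation killing `μ`
(`isInverseOn_of_contract_eq`). These computations take place in the exterior algebra of the dual
space, where contraction is Mathlib's `CliffordAlgebra.contractLeft`; `Represents` is the dictionary
with alternating forms, and it turns `wedge` into the product.

The remaining hypotheses are used through their values on special vectors: `dα_i ∧ μ = 0` and
`dϖ ∧ μ = 0` say that `dα_i` and `dϖ` vanish on `D`, and `(i_{X^j} μ) ∧ dϖ = 0` says that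
`dϖ (X^j, u, v) = 0` for `u, v` in `D`. Differentiating `ϖ (Π^♯ a, Π^♯ b) = Π (a, b)` in a chart,
for constant covectors `a` and `b`, then gives two facts about vector spaces.
* `[Π, Π] = 0`: this is the closedness of `ϖ` on `D`, since the brackets of the fields `Π^♯ a` stay
  in `D` (`IsInverseNear.schoutenSelf_eq_zero`).
* `[Π, X] = 0` for every `X` with `i_X ϖ = 0`, with `dϖ (X, ·, ·)` zero on `D`, and whose brackets
  with the fields `Π^♯ a` lie in `D` (`IsInverseNear.schoutenVec_eq_zero`).

For `X = X^j` the condition on brackets comes from `i_{X_f} L_X μ = 0`: as `i_{Π^♯ a} μ = 0`, the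
form `i_{Π^♯ a} L_X μ` is `- i_{[X, Π^♯ a]} μ`, whose vanishing means `[X, Π^♯ a] ∈ D`
(`IsInverseNear.bracket_tangent`); every covector at a point is the differential of a global
function, by a bump function. The transversal distribution is the span of the `X^j`. A field `X` in
it satisfies the first two conditions by linearity, and the bracket condition when it preserves the
foliation (`bracket_tangent_of_preservesOn`).
-/

noncomputable section

namespace FoliatedPoisson

/-! ### Alternating forms as elements of the exterior algebra of the dual space -/

section Exterior

variable {E : Type*} [AddCommGroup E] [Module ℝ E]

/-- The contraction of an element of the exterior algebra of the dual space with a vector. -/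
def ctr (v : E) : ExteriorAlgebra ℝ (Module.Dual ℝ E) →ₗ[ℝ] ExteriorAlgebra ℝ (Module.Dual ℝ E) :=
  CliffordAlgebra.contractLeft (Q := 0) (Module.Dual.eval ℝ E v)

theorem ctr_ι_mul (v : E) (a : Module.Dual ℝ E) (x : ExteriorAlgebra ℝ (Module.Dual ℝ E)) :
    ctr v (ExteriorAlgebra.ι ℝ a * x) = a v • x - ExteriorAlgebra.ι ℝ a * ctr v x :=
  CliffordAlgebra.contractLeft_ι_mul (Q := 0) (Module.Dual.eval ℝ E v) a x

theorem ctr_ι (v : E) (a : Module.Dual ℝ E) :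
    ctr v (ExteriorAlgebra.ι ℝ a) = algebraMap ℝ _ (a v) :=
  CliffordAlgebra.contractLeft_ι (Q := 0) (Module.Dual.eval ℝ E v) a

theorem ctr_algebraMap (v : E) (c : ℝ) :
    ctr v (algebraMap ℝ (ExteriorAlgebra ℝ (Module.Dual ℝ E)) c) = 0 :=
  CliffordAlgebra.contractLeft_algebraMap (Q := 0) (Module.Dual.eval ℝ E v) c

theorem ctr_add_left (u v : E) (x : ExteriorAlgebra ℝ (Module.Dual ℝ E)) :
    ctr (u + v) x = ctr u x + ctr v x := by
  simp [ctr]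

theorem ctr_smul_left (c : ℝ) (v : E) (x : ExteriorAlgebra ℝ (Module.Dual ℝ E)) :
    ctr (c • v) x = c • ctr v x := by
  simp [ctr]

theorem ctr_sum_left {ι : Type*} (s : Finset ι) (v : ι → E)
    (x : ExteriorAlgebra ℝ (Module.Dual ℝ E)) :
    ctr (∑ i ∈ s, v i) x = ∑ i ∈ s, ctr (v i) x := by
  simp [ctr]

/-- Induction on elements of the exterior powers, by left multiplication with covectors. -/
theorem exteriorPower_induction {V : Type*} [AddCommGroup V] [Module ℝ V]
    {C : ℕ → ExteriorAlgebra ℝ V → Prop}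
    (scalar : ∀ c : ℝ, C 0 (algebraMap ℝ _ c))
    (add : ∀ n x y, C n x → C n y → C n (x + y))
    (mul : ∀ n a x, x ∈ ⋀[ℝ]^n V → C n x → C (n + 1) (ExteriorAlgebra.ι ℝ a * x))
    {n : ℕ} {x : ExteriorAlgebra ℝ V} (hx : x ∈ ⋀[ℝ]^n V) : C n x := by
  refine Submodule.pow_induction_on_left' (M := LinearMap.range (ExteriorAlgebra.ι ℝ))
    (C := fun n x _ => C n x) scalar (fun x y n _ _ => add n x y) ?_ hx
  rintro _ ⟨a, rfl⟩ n x hx ih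
  exact mul n a x hx ih

theorem mem_exteriorPower_iff {V : Type*} [AddCommGroup V] [Module ℝ V] {n : ℕ}
    {x : ExteriorAlgebra ℝ V} :
    x ∈ ⋀[ℝ]^n V ↔ x ∈ LinearMap.range (ExteriorAlgebra.ι ℝ : V →ₗ[ℝ] _) ^ n := Iff.rfl

theorem ι_mul_mem {V : Type*} [AddCommGroup V] [Module ℝ V] {n : ℕ} (a : V)
    {x : ExteriorAlgebra ℝ V} (hx : x ∈ ⋀[ℝ]^n V) :
    ExteriorAlgebra.ι ℝ a * x ∈ ⋀[ℝ]^(n + 1) V := by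
  rw [mem_exteriorPower_iff, pow_succ']
  exact Submodule.mul_mem_mul ⟨a, rfl⟩ hx

theorem ι_mem {V : Type*} [AddCommGroup V] [Module ℝ V] (a : V) :
    ExteriorAlgebra.ι ℝ a ∈ ⋀[ℝ]^1 V := by
  rw [mem_exteriorPower_iff, pow_one]
  exact ⟨a, rfl⟩

theorem mul_mem_exteriorPower {V : Type*} [AddCommGroup V] [Module ℝ V] {p q : ℕ}
    {x y : ExteriorAlgebra ℝ V} (hx : x ∈ ⋀[ℝ]^p V) (hy : y ∈ ⋀[ℝ]^q V) :
    x * y ∈ ⋀[ℝ]^(p + q) V := by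
  rw [mem_exteriorPower_iff, pow_add]
  exact Submodule.mul_mem_mul hx hy

theorem algebraMap_mem_exteriorPower {V : Type*} [AddCommGroup V] [Module ℝ V] (c : ℝ) :
    algebraMap ℝ (ExteriorAlgebra ℝ V) c ∈ ⋀[ℝ]^0 V := by
  rw [mem_exteriorPower_iff, pow_zero]
  exact Submodule.algebraMap_mem c

theorem exists_eq_algebraMap_of_mem {V : Type*} [AddCommGroup V] [Module ℝ V]
    {x : ExteriorAlgebra ℝ V} (hx : x ∈ ⋀[ℝ]^0 V) : ∃ c : ℝ, x = algebraMap ℝ _ c := by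
  rw [mem_exteriorPower_iff, pow_zero] at hx
  obtain ⟨c, hc⟩ := Submodule.mem_one.mp hx
  exact ⟨c, hc.symm⟩

theorem ctr_mem (v : E) {n : ℕ} {x : ExteriorAlgebra ℝ (Module.Dual ℝ E)}
    (hx : x ∈ ⋀[ℝ]^(n + 1) (Module.Dual ℝ E)) : ctr v x ∈ ⋀[ℝ]^n (Module.Dual ℝ E) := by
  have key : ∀ {n : ℕ} {x : ExteriorAlgebra ℝ (Module.Dual ℝ E)},
      x ∈ ⋀[ℝ]^n (Module.Dual ℝ E) → ∀ k, n = k + 1 → ctr v x ∈ ⋀[ℝ]^k (Module.Dual ℝ E) := by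
    intro n x hx
    refine exteriorPower_induction (C := fun n x => ∀ k, n = k + 1 →
      ctr v x ∈ ⋀[ℝ]^k (Module.Dual ℝ E)) ?_ ?_ ?_ hx
    · intro c k hk
      omega
    · intro n x y hx hy k hk
      rw [map_add]
      exact add_mem (hx k hk) (hy k hk)
    · intro n a x hx ih k hk
      obtain rfl : n = k := by omega
      rw [ctr_ι_mul]
      refine sub_mem (Submodule.smul_mem _ _ hx) ?_
      cases n with
      | zero =>
        obtain ⟨c, rfl⟩ := exists_eq_algebraMap_of_mem hx
        rw [ctr_algebraMap, mul_zero]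
        exact zero_mem _
      | succ n => exact ι_mul_mem a (ih n rfl)
  exact key hx n rfl

/-- Contraction with a vector is an antiderivation. -/
theorem ctr_mul (v : E) {q : ℕ} {y : ExteriorAlgebra ℝ (Module.Dual ℝ E)}
    (hy : y ∈ ⋀[ℝ]^q (Module.Dual ℝ E)) (x : ExteriorAlgebra ℝ (Module.Dual ℝ E)) :
    ctr v (y * x) = ctr v y * x + (-1 : ℝ) ^ q • (y * ctr v x) := by
  refine exteriorPower_induction (C := fun q y =>
    ctr v (y * x) = ctr v y * x + (-1 : ℝ) ^ q • (y * ctr v x)) ?_ ?_ ?_ hy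
  · intro c
    rw [ctr_algebraMap, ← Algebra.smul_def, ← Algebra.smul_def, map_smul]
    simp
  · intro n y z hy hz
    simp only [add_mul, map_add, hy, hz, smul_add]
    abel
  · intro n a y _ ih
    rw [mul_assoc, ctr_ι_mul, ctr_ι_mul, ih, pow_succ]
    simp only [mul_add, sub_mul, smul_mul_assoc, mul_smul_comm, mul_assoc, mul_neg, mul_one,
      neg_smul]
    abel

theorem ι_mul_comm {V : Type*} [AddCommGroup V] [Module ℝ V] (a : V) {q : ℕ}
    {y : ExteriorAlgebra ℝ V} (hy : y ∈ ⋀[ℝ]^q V) :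
    ExteriorAlgebra.ι ℝ a * y = (-1 : ℝ) ^ q • (y * ExteriorAlgebra.ι ℝ a) := by
  refine exteriorPower_induction (C := fun q y =>
    ExteriorAlgebra.ι ℝ a * y = (-1 : ℝ) ^ q • (y * ExteriorAlgebra.ι ℝ a)) ?_ ?_ ?_ hy
  · intro c
    rw [← Algebra.commutes]
    simp
  · intro n y z hy hz
    simp only [add_mul, mul_add, hy, hz, smul_add]
  · intro n b y _ ih
    have h := eq_neg_of_add_eq_zero_left (ExteriorAlgebra.ι_add_mul_swap (R := ℝ) a b)
    rw [← mul_assoc, h, neg_mul, mul_assoc, ih, pow_succ]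
    simp [mul_assoc]

/-- The value of the degree `n` part of `x` on `n` vectors: the scalar part of the successive
contractions of `x` with these vectors. -/
def ev : (n : ℕ) → ExteriorAlgebra ℝ (Module.Dual ℝ E) →ₗ[ℝ] ((Fin n → E) → ℝ)
  | 0 => LinearMap.pi fun _ => ExteriorAlgebra.algebraMapInv.toLinearMap
  | n + 1 => LinearMap.pi fun v => LinearMap.proj (Fin.tail v) ∘ₗ ev n ∘ₗ ctr (v 0)

theorem ev_zero_algebraMap (c : ℝ) (v : Fin 0 → E) : ev 0 (algebraMap ℝ _ c) v = c :=
  ExteriorAlgebra.algebraMap_leftInverse _ c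

theorem ev_succ (n : ℕ) (x : ExteriorAlgebra ℝ (Module.Dual ℝ E)) (v : Fin (n + 1) → E) :
    ev (n + 1) x v = ev n (ctr (v 0) x) (Fin.tail v) := rfl

theorem ev_cons (n : ℕ) (x : ExteriorAlgebra ℝ (Module.Dual ℝ E)) (u : E) (v : Fin n → E) :
    ev (n + 1) x (Matrix.vecCons u v) = ev n (ctr u x) v := rfl

/-- Expansion of the value of `a ∧ x` along the covector `a`. -/
theorem ev_ι_mul (a : Module.Dual ℝ E) (n : ℕ) (x : ExteriorAlgebra ℝ (Module.Dual ℝ E))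
    (v : Fin (n + 1) → E) :
    ev (n + 1) (ExteriorAlgebra.ι ℝ a * x) v
      = ∑ j : Fin (n + 1), (-1) ^ (j : ℕ) * a (v j) * ev n x (j.removeNth v) := by
  induction n generalizing x with
  | zero =>
    rw [ev_succ, ctr_ι_mul]
    have h : ev 0 (ExteriorAlgebra.ι ℝ a * ctr (v 0) x) (Fin.tail v) = 0 := by
      change ExteriorAlgebra.algebraMapInv (ExteriorAlgebra.ι ℝ a * ctr (v 0) x) = 0
      simp [ExteriorAlgebra.algebraMapInv]
    rw [map_sub, map_smul, Pi.sub_apply, h]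
    simp
  | succ n ih =>
    rw [ev_succ, ctr_ι_mul, map_sub, map_smul, Pi.sub_apply, ih, Fin.sum_univ_succ (n := n + 1),
      Pi.smul_apply]
    simp only [Fin.val_zero, pow_zero, one_mul, smul_eq_mul, sub_eq_add_neg,
      ← Finset.sum_neg_distrib]
    congr 1
    refine Finset.sum_congr rfl fun j _ => ?_
    rw [ev_succ n x, Fin.val_succ, pow_succ]
    have h0 : (j.succ.removeNth v) 0 = v 0 := by simp [Fin.removeNth]
    have h1 : Fin.tail (j.succ.removeNth v) = j.removeNth (Fin.tail v) := by
      ext i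
      simp [Fin.removeNth, Fin.tail]
    rw [h0, h1]
    simp [Fin.tail]

theorem ev_ιMulti (n : ℕ) (a : Fin n → Module.Dual ℝ E) (v : Fin n → E) :
    ev n (ExteriorAlgebra.ιMulti ℝ n a) v = (Matrix.of fun i j => a i (v j)).det := by
  induction n with
  | zero =>
    rw [ExteriorAlgebra.ιMulti_zero_apply, Matrix.det_fin_zero, ← map_one (algebraMap ℝ _),
      ev_zero_algebraMap]
  | succ n ih =>
    rw [ExteriorAlgebra.ιMulti_succ_apply, ev_ι_mul, Matrix.det_succ_row_zero]
    refine Finset.sum_congr rfl fun j _ => ?_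
    rw [ih]
    rfl

/-- The alternating form `a₁ ∧ ⋯ ∧ a_n`, as the alternatization of `a₁ ⊗ ⋯ ⊗ a_n`. -/
def altForm {ι : Type*} [Fintype ι] [DecidableEq ι] (a : ι → Module.Dual ℝ E) :
    E [⋀^ι]→ₗ[ℝ] ℝ :=
  MultilinearMap.alternatization ((MultilinearMap.mkPiRing ℝ ι (1 : ℝ)).compLinearMap a)

theorem altForm_apply {ι : Type*} [Fintype ι] [DecidableEq ι] (a : ι → Module.Dual ℝ E)
    (v : ι → E) : altForm a v = (Matrix.of fun i j => a i (v j)).det := by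
  rw [← Matrix.det_transpose, Matrix.det_apply, altForm, MultilinearMap.alternatization_apply]
  refine Finset.sum_congr rfl fun σ _ => ?_
  simp

/-- The wedge product of algebraic alternating forms. -/
def algWedge {p q : ℕ} (f : E [⋀^Fin p]→ₗ[ℝ] ℝ) (g : E [⋀^Fin q]→ₗ[ℝ] ℝ) :
    E [⋀^Fin (p + q)]→ₗ[ℝ] ℝ :=
  ((LinearMap.mul' ℝ ℝ).compAlternatingMap (f.domCoprod g)).domDomCongr finSumFinEquiv

theorem algWedge_eq {p q : ℕ} (f : E [⋀^Fin p]→ₗ[ℝ] ℝ) (g : E [⋀^Fin q]→ₗ[ℝ] ℝ) :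
    algWedge f g = ((LinearMap.mul' ℝ ℝ).compAlternatingMap
      (AlternatingMap.domCoprod' (f ⊗ₜ[ℝ] g))).domDomCongr finSumFinEquiv := rfl

open TensorProduct in
theorem algWedge_add_left {p q : ℕ} (f f' : E [⋀^Fin p]→ₗ[ℝ] ℝ) (g : E [⋀^Fin q]→ₗ[ℝ] ℝ) :
    algWedge (f + f') g = algWedge f g + algWedge f' g := by
  ext v
  simp [algWedge_eq, add_tmul, -AlternatingMap.domCoprod'_apply]

open TensorProduct in
theorem algWedge_add_right {p q : ℕ} (f : E [⋀^Fin p]→ₗ[ℝ] ℝ) (g g' : E [⋀^Fin q]→ₗ[ℝ] ℝ) :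
    algWedge f (g + g') = algWedge f g + algWedge f g' := by
  ext v
  simp [algWedge_eq, tmul_add, -AlternatingMap.domCoprod'_apply]

open TensorProduct in
theorem algWedge_smul_left {p q : ℕ} (c : ℝ) (f : E [⋀^Fin p]→ₗ[ℝ] ℝ) (g : E [⋀^Fin q]→ₗ[ℝ] ℝ) :
    algWedge (c • f) g = c • algWedge f g := by
  ext v
  simp [algWedge_eq, ← smul_tmul', -AlternatingMap.domCoprod'_apply]

open TensorProduct in
theorem algWedge_smul_right {p q : ℕ} (c : ℝ) (f : E [⋀^Fin p]→ₗ[ℝ] ℝ) (g : E [⋀^Fin q]→ₗ[ℝ] ℝ) :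
    algWedge f (c • g) = c • algWedge f g := by
  ext v
  simp [algWedge_eq, -AlternatingMap.domCoprod'_apply]

theorem algWedge_altForm {p q : ℕ} (a : Fin p → Module.Dual ℝ E) (b : Fin q → Module.Dual ℝ E) :
    algWedge (altForm a) (altForm b) = altForm (Fin.append a b) := by
  ext v
  rw [algWedge, altForm, altForm, ← MultilinearMap.domCoprod_alternization, altForm]
  simp only [AlternatingMap.domDomCongr_apply, LinearMap.compAlternatingMap_apply,
    MultilinearMap.alternatization_apply, map_sum]
  refine Fintype.sum_equiv (finSumFinEquiv.permCongr) _ _ fun σ => ?_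
  rw [Equiv.Perm.sign_permCongr]
  simp only [Units.smul_def, map_zsmul]
  congr 1
  simp [Fin.prod_univ_add, Function.comp_def]

theorem exists_coe_eq_ev {n : ℕ} {x : ExteriorAlgebra ℝ (Module.Dual ℝ E)}
    (hx : x ∈ ⋀[ℝ]^n (Module.Dual ℝ E)) : ∃ f : E [⋀^Fin n]→ₗ[ℝ] ℝ, ⇑f = ev n x := by
  rw [← ExteriorAlgebra.ιMulti_span_fixedDegree] at hx
  induction hx using Submodule.span_induction with
  | mem x hx =>
    obtain ⟨a, rfl⟩ := hx
    refine ⟨altForm a, ?_⟩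
    ext v
    rw [altForm_apply, ev_ιMulti]
  | zero => exact ⟨0, by rw [map_zero]; rfl⟩
  | add x y _ _ hx hy =>
    obtain ⟨f, hf⟩ := hx
    obtain ⟨g, hg⟩ := hy
    exact ⟨f + g, by rw [map_add, ← hf, ← hg]; rfl⟩
  | smul c x _ hx =>
    obtain ⟨f, hf⟩ := hx
    exact ⟨c • f, by rw [map_smul, ← hf]; rfl⟩

/-- Products in the exterior algebra correspond to wedge products of forms. -/
theorem exists_ev_mul {p q : ℕ} {x y : ExteriorAlgebra ℝ (Module.Dual ℝ E)}
    (hx : x ∈ ⋀[ℝ]^p (Module.Dual ℝ E)) (hy : y ∈ ⋀[ℝ]^q (Module.Dual ℝ E)) :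
    ∃ (f : E [⋀^Fin p]→ₗ[ℝ] ℝ) (g : E [⋀^Fin q]→ₗ[ℝ] ℝ), ⇑f = ev p x ∧ ⇑g = ev q y ∧
      ⇑(algWedge f g) = ev (p + q) (x * y) := by
  rw [← ExteriorAlgebra.ιMulti_span_fixedDegree] at hx hy
  induction hx, hy using Submodule.span_induction₂ with
  | mem_mem x y hx hy =>
    obtain ⟨a, rfl⟩ := hx
    obtain ⟨b, rfl⟩ := hy
    refine ⟨altForm a, altForm b, ?_, ?_, ?_⟩
    · ext v
      rw [altForm_apply, ev_ιMulti]
    · ext v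
      rw [altForm_apply, ev_ιMulti]
    · ext v
      rw [algWedge_altForm, ExteriorAlgebra.ιMulti_mul_ιMulti, ev_ιMulti, altForm_apply]
  | zero_left y hy =>
    rw [ExteriorAlgebra.ιMulti_span_fixedDegree] at hy
    obtain ⟨g, hg⟩ := exists_coe_eq_ev hy
    refine ⟨0, g, by rw [map_zero]; rfl, hg, ?_⟩
    rw [← zero_smul ℝ 0, algWedge_smul_left, zero_smul, zero_mul, map_zero]
    rfl
  | zero_right x hx =>
    rw [ExteriorAlgebra.ιMulti_span_fixedDegree] at hx
    obtain ⟨f, hf⟩ := exists_coe_eq_ev hx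
    refine ⟨f, 0, hf, by rw [map_zero]; rfl, ?_⟩
    rw [← zero_smul ℝ 0, algWedge_smul_right, zero_smul, mul_zero, map_zero]
    rfl
  | add_left x y z hx hy hz hx' hy' =>
    obtain ⟨f, g, hf, hg, hfg⟩ := hx'
    obtain ⟨f', g', hf', hg', hfg'⟩ := hy'
    obtain rfl : g = g' := DFunLike.coe_injective (hg.trans hg'.symm)
    refine ⟨f + f', g, ?_, hg, ?_⟩
    · rw [map_add, ← hf, ← hf']
      rfl
    · rw [algWedge_add_left, add_mul, map_add, ← hfg, ← hfg']
      rfl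
  | add_right x y z hx hy hz hx' hy' =>
    obtain ⟨f, g, hf, hg, hfg⟩ := hx'
    obtain ⟨f', g', hf', hg', hfg'⟩ := hy'
    obtain rfl : f = f' := DFunLike.coe_injective (hf.trans hf'.symm)
    refine ⟨f, g + g', hf, ?_, ?_⟩
    · rw [map_add, ← hg, ← hg']
      rfl
    · rw [algWedge_add_right, mul_add, map_add, ← hfg, ← hfg']
      rfl
  | smul_left c x y hx hy h =>
    obtain ⟨f, g, hf, hg, hfg⟩ := h
    refine ⟨c • f, g, ?_, hg, ?_⟩
    · rw [map_smul, ← hf]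
      rfl
    · rw [algWedge_smul_left, smul_mul_assoc, map_smul, ← hfg]
      rfl
  | smul_right c x y hx hy h =>
    obtain ⟨f, g, hf, hg, hfg⟩ := h
    refine ⟨f, c • g, hf, ?_, ?_⟩
    · rw [map_smul, ← hg]
      rfl
    · rw [algWedge_smul_right, mul_smul_comm, map_smul, ← hfg]
      rfl

end Exterior

/-! ### Identities for `a₁ ∧ ⋯ ∧ a_k` and for the powers of a 2-form -/

section Algebra

variable {E : Type*} [AddCommGroup E] [Module ℝ E]

theorem ι_mul_ιMulti_self {V : Type*} [AddCommGroup V] [Module ℝ V] {k : ℕ} (a : Fin k → V)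
    (i : Fin k) : ExteriorAlgebra.ι ℝ (a i) * ExteriorAlgebra.ιMulti ℝ k a = 0 := by
  have h : ExteriorAlgebra.ι ℝ (a i) * ExteriorAlgebra.ιMulti ℝ k a
      = ExteriorAlgebra.ιMulti ℝ (k + 1) (Matrix.vecCons (a i) a) := by
    rw [ExteriorAlgebra.ιMulti_succ_apply]
    rfl
  rw [h]
  exact AlternatingMap.map_eq_zero_of_eq _ _ (i := 0) (j := i.succ) (by simp)
    (Fin.succ_ne_zero i).symm

theorem ctr_ιMulti_eq_zero {k : ℕ} (a : Fin k → Module.Dual ℝ E) (v : E) (hv : ∀ i, a i v = 0) :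
    ctr v (ExteriorAlgebra.ιMulti ℝ k a) = 0 := by
  induction k with
  | zero =>
    rw [ExteriorAlgebra.ιMulti_zero_apply, ← map_one (algebraMap ℝ _), ctr_algebraMap]
  | succ k ih =>
    rw [ExteriorAlgebra.ιMulti_succ_apply, ctr_ι_mul, hv, zero_smul, zero_sub,
      ih (Matrix.vecTail a) fun i => hv i.succ, mul_zero, neg_zero]

theorem smul_ιMulti_eq {k : ℕ} (a : Fin k → Module.Dual ℝ E) (v : E) (i : Fin k) :
    a i v • ExteriorAlgebra.ιMulti ℝ k a
      = ExteriorAlgebra.ι ℝ (a i) * ctr v (ExteriorAlgebra.ιMulti ℝ k a) := by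
  have h := ctr_ι_mul v (a i) (ExteriorAlgebra.ιMulti ℝ k a)
  rw [ι_mul_ιMulti_self, map_zero] at h
  exact (sub_eq_zero.mp h.symm)

/-- The antiderivation rule for the powers of a 2-form. -/
theorem ctr_pow_succ {x : ExteriorAlgebra ℝ (Module.Dual ℝ E)}
    (hx : x ∈ ⋀[ℝ]^2 (Module.Dual ℝ E)) (v : E) (r : ℕ) :
    ctr v (x ^ (r + 1)) = ((r + 1 : ℕ) : ℝ) • (ctr v x * x ^ r) := by
  induction r with
  | zero => simp
  | succ r ih =>
    obtain ⟨b, hb⟩ : ∃ b, ExteriorAlgebra.ι ℝ b = ctr v x := by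
      have h := ctr_mem v hx
      rw [mem_exteriorPower_iff, pow_one] at h
      exact h
    rw [pow_succ' x (r + 1), ctr_mul v hx, ih, ← hb, mul_smul_comm, ← mul_assoc x]
    have hc : x * ExteriorAlgebra.ι ℝ b = ExteriorAlgebra.ι ℝ b * x := by
      rw [ι_mul_comm b hx]
      simp
    rw [hc, mul_assoc, ← pow_succ', smul_smul, Nat.cast_add (r + 1), add_smul]
    simp [add_comm]

end Algebra

/-! ### Forms represented by elements of the exterior algebra -/

section Represents

variable {E : Type*} [AddCommGroup E] [Module ℝ E] [TopologicalSpace E]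

/-- `x` represents the form `f`: it is homogeneous of the same degree, and has the same values. -/
def Represents {n : ℕ} (x : ExteriorAlgebra ℝ (Module.Dual ℝ E)) (f : E [⋀^Fin n]→L[ℝ] ℝ) : Prop :=
  x ∈ ⋀[ℝ]^n (Module.Dual ℝ E) ∧ ⇑f = ev n x

theorem wedge_apply {p q : ℕ} (f : E [⋀^Fin p]→L[ℝ] ℝ) (g : E [⋀^Fin q]→L[ℝ] ℝ)
    (v : Fin (p + q) → E) : wedge f g v = algWedge f.toAlternatingMap g.toAlternatingMap v := rfl

theorem interior_apply {n : ℕ} (u : E) (f : E [⋀^Fin (n + 1)]→L[ℝ] ℝ) (v : Fin n → E) :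
    interior u f v = f (Matrix.vecCons u v) := rfl

theorem wedge_zero_left {p q : ℕ} (g : E [⋀^Fin q]→L[ℝ] ℝ) :
    wedge (0 : E [⋀^Fin p]→L[ℝ] ℝ) g = 0 := by
  ext v
  have := congrArg (fun F => F v)
    (algWedge_smul_left (0 : ℝ) (0 : E [⋀^Fin p]→ₗ[ℝ] ℝ) g.toAlternatingMap)
  simpa [wedge_apply] using this

theorem Represents.wedge {p q : ℕ} {x y : ExteriorAlgebra ℝ (Module.Dual ℝ E)}
    {f : E [⋀^Fin p]→L[ℝ] ℝ} {g : E [⋀^Fin q]→L[ℝ] ℝ} (hx : Represents x f)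
    (hy : Represents y g) : Represents (x * y) (wedge f g) := by
  refine ⟨mul_mem_exteriorPower hx.1 hy.1, ?_⟩
  obtain ⟨F, G, hF, hG, hFG⟩ := exists_ev_mul hx.1 hy.1
  have h1 : f.toAlternatingMap = F := DFunLike.coe_injective (hx.2.trans hF.symm)
  have h2 : g.toAlternatingMap = G := DFunLike.coe_injective (hy.2.trans hG.symm)
  rw [← hFG, ← h1, ← h2]
  rfl

theorem Represents.interior {n : ℕ} {x : ExteriorAlgebra ℝ (Module.Dual ℝ E)}
    {f : E [⋀^Fin (n + 1)]→L[ℝ] ℝ} (hx : Represents x f) (u : E) :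
    Represents (n := n) (ctr u x) (interior u f) := by
  refine ⟨ctr_mem u hx.1, ?_⟩
  ext v
  rw [interior_apply, hx.2, ev_cons]

theorem Represents.add {n : ℕ} {x y : ExteriorAlgebra ℝ (Module.Dual ℝ E)}
    {f g : E [⋀^Fin n]→L[ℝ] ℝ} (hx : Represents x f) (hy : Represents y g) :
    Represents (x + y) (f + g) := by
  refine ⟨add_mem hx.1 hy.1, ?_⟩
  rw [map_add, ← hx.2, ← hy.2]
  rfl

theorem Represents.smul {n : ℕ} {x : ExteriorAlgebra ℝ (Module.Dual ℝ E)}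
    {f : E [⋀^Fin n]→L[ℝ] ℝ} (c : ℝ) (hx : Represents x f) : Represents (c • x) (c • f) := by
  refine ⟨Submodule.smul_mem _ _ hx.1, ?_⟩
  rw [map_smul, ← hx.2]
  rfl

theorem represents_zero (n : ℕ) :
    Represents (0 : ExteriorAlgebra ℝ (Module.Dual ℝ E)) (0 : E [⋀^Fin n]→L[ℝ] ℝ) := by
  refine ⟨zero_mem _, ?_⟩
  rw [map_zero]
  rfl

theorem Represents.sum {n : ℕ} {ι : Type*} (s : Finset ι)
    {x : ι → ExteriorAlgebra ℝ (Module.Dual ℝ E)} {f : ι → E [⋀^Fin n]→L[ℝ] ℝ}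
    (h : ∀ i, Represents (x i) (f i)) : Represents (∑ i ∈ s, x i) (∑ i ∈ s, f i) := by
  classical
  induction s using Finset.induction_on with
  | empty => simpa using represents_zero n
  | insert i s hi ih =>
    rw [Finset.sum_insert hi, Finset.sum_insert hi]
    exact (h i).add ih

/-- The covector `v ↦ a (v)` of a 1-form `a`. -/
def covec (a : E [⋀^Fin 1]→L[ℝ] ℝ) : Module.Dual ℝ E where
  toFun v := a ![v]
  map_add' u v := ContinuousAlternatingMap.vecCons_add a ![] u v
  map_smul' c v := ContinuousAlternatingMap.vecCons_smul a ![] c v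

@[simp]
theorem covec_apply (a : E [⋀^Fin 1]→L[ℝ] ℝ) (v : E) : covec a v = a ![v] := rfl

theorem represents_covec (a : E [⋀^Fin 1]→L[ℝ] ℝ) :
    Represents (ExteriorAlgebra.ι ℝ (covec a)) a := by
  refine ⟨ι_mem _, ?_⟩
  ext v
  rw [ev_succ, ctr_ι, ev_zero_algebraMap, covec_apply]
  congr 1
  ext i
  fin_cases i
  rfl

theorem represents_one : Represents (1 : ExteriorAlgebra ℝ (Module.Dual ℝ E))
    (ContinuousAlternatingMap.constOfIsEmpty ℝ E (Fin 0) (1 : ℝ)) := by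
  rw [← map_one (algebraMap ℝ _)]
  refine ⟨algebraMap_mem_exteriorPower 1, ?_⟩
  ext v
  rw [ev_zero_algebraMap]
  rfl

theorem ιMulti_castSucc {V : Type*} [AddCommGroup V] [Module ℝ V] {k : ℕ} (a : Fin (k + 1) → V) :
    ExteriorAlgebra.ιMulti ℝ k (fun i => a i.castSucc) * ExteriorAlgebra.ι ℝ (a (Fin.last k))
      = ExteriorAlgebra.ιMulti ℝ (k + 1) a := by
  rw [ExteriorAlgebra.ιMulti_apply, ExteriorAlgebra.ιMulti_apply, List.ofFn_succ',
    List.concat_eq_append, List.prod_append, List.prod_singleton]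

theorem represents_wedgeFamily : ∀ {k : ℕ} (a : Fin k → E [⋀^Fin 1]→L[ℝ] ℝ),
    Represents (ExteriorAlgebra.ιMulti ℝ k fun i => covec (a i)) (wedgeFamily k a)
  | 0, a => by
    rw [ExteriorAlgebra.ιMulti_zero_apply]
    exact represents_one
  | k + 1, a => by
    rw [← ιMulti_castSucc]
    exact (represents_wedgeFamily fun i => a i.castSucc).wedge (represents_covec _)

theorem Represents.wedgePow {x : ExteriorAlgebra ℝ (Module.Dual ℝ E)} {f : E [⋀^Fin 2]→L[ℝ] ℝ}
    (hx : Represents x f) : ∀ r : ℕ, Represents (x ^ r) (wedgePow f r)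
  | 0 => by
    rw [pow_zero]
    exact represents_one
  | r + 1 => by
    rw [pow_succ]
    exact (hx.wedgePow r).wedge hx

/-- The contraction of the 2-form represented by `x` with `v`. -/
theorem Represents.ctr_eq_ι {x : ExteriorAlgebra ℝ (Module.Dual ℝ E)} {f : E [⋀^Fin 2]→L[ℝ] ℝ}
    (hx : Represents x f) (v : E) :
    ctr v x = ExteriorAlgebra.ι ℝ (covec (FoliatedPoisson.interior v f)) := by
  have h := ctr_mem v hx.1
  rw [mem_exteriorPower_iff, pow_one] at h
  obtain ⟨b, hb⟩ := h
  rw [← hb]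
  congr 1
  ext w
  have h1 := congrFun hx.2 ![v, w]
  rw [ev_cons, ← hb, ev_succ, ctr_ι, ev_zero_algebraMap] at h1
  exact h1.symm

end Represents

/-! ### The isomorphism between forms and elements of the exterior powers -/

section Iso

variable {E : Type*} [AddCommGroup E] [Module ℝ E]

/-- Euler's identity for the degree of a form. -/
theorem sum_coord_mul_ctr {ι : Type*} [Fintype ι] (e : Module.Basis ι ℝ E) {n : ℕ}
    {x : ExteriorAlgebra ℝ (Module.Dual ℝ E)} (hx : x ∈ ⋀[ℝ]^n (Module.Dual ℝ E)) :
    ∑ i, ExteriorAlgebra.ι ℝ (e.coord i) * ctr (e i) x = (n : ℝ) • x := by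
  refine exteriorPower_induction (C := fun n x =>
    ∑ i, ExteriorAlgebra.ι ℝ (e.coord i) * ctr (e i) x = (n : ℝ) • x) ?_ ?_ ?_ hx
  · intro c
    simp [ctr_algebraMap]
  · intro n x y hx hy
    simp only [map_add, mul_add, Finset.sum_add_distrib, hx, hy, smul_add]
  · intro n a x _ ih
    have ha : a = ∑ i, a (e i) • e.coord i := by
      refine e.ext fun j => ?_
      classical
      simp
    have h1 : ∀ i, ExteriorAlgebra.ι ℝ (e.coord i) * ctr (e i) (ExteriorAlgebra.ι ℝ a * x)
        = ExteriorAlgebra.ι ℝ (a (e i) • e.coord i) * x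
          + ExteriorAlgebra.ι ℝ a * (ExteriorAlgebra.ι ℝ (e.coord i) * ctr (e i) x) := by
      intro i
      have h := eq_neg_of_add_eq_zero_left
        (ExteriorAlgebra.ι_add_mul_swap (R := ℝ) (e.coord i) a)
      rw [ctr_ι_mul, mul_sub, ← mul_assoc, h, map_smul, mul_smul_comm, smul_mul_assoc, neg_mul,
        sub_neg_eq_add, mul_assoc]
    rw [Finset.sum_congr rfl fun i _ => h1 i, Finset.sum_add_distrib, ← Finset.sum_mul, ← map_sum,
      ← ha, ← Finset.mul_sum, ih, mul_smul_comm, Nat.cast_succ, add_smul, one_smul, add_comm]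

theorem eq_zero_of_ctr_eq_zero [FiniteDimensional ℝ E] {n : ℕ}
    {x : ExteriorAlgebra ℝ (Module.Dual ℝ E)} (hx : x ∈ ⋀[ℝ]^(n + 1) (Module.Dual ℝ E))
    (h : ∀ v, ctr v x = 0) : x = 0 := by
  have h1 := sum_coord_mul_ctr (Module.finBasis ℝ E) hx
  simp only [h, mul_zero, Finset.sum_const_zero] at h1
  refine (smul_eq_zero.mp h1.symm).resolve_left ?_
  exact_mod_cast n.succ_ne_zero

theorem eq_zero_of_ev_eq_zero [FiniteDimensional ℝ E] {n : ℕ}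
    {x : ExteriorAlgebra ℝ (Module.Dual ℝ E)} (hx : x ∈ ⋀[ℝ]^n (Module.Dual ℝ E))
    (h : ev n x = 0) : x = 0 := by
  induction n generalizing x with
  | zero =>
    obtain ⟨c, rfl⟩ := exists_eq_algebraMap_of_mem hx
    have := congrFun h ![]
    rw [ev_zero_algebraMap] at this
    rw [this, Pi.zero_apply, map_zero]
  | succ n ih =>
    refine eq_zero_of_ctr_eq_zero hx fun v => ih (ctr_mem v hx) ?_
    ext w
    exact congrFun h (Matrix.vecCons v w)

variable [TopologicalSpace E]

theorem Represents.eq_zero_iff [FiniteDimensional ℝ E] {n : ℕ}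
    {x : ExteriorAlgebra ℝ (Module.Dual ℝ E)} {f : E [⋀^Fin n]→L[ℝ] ℝ} (h : Represents x f) :
    x = 0 ↔ f = 0 := by
  constructor
  · rintro rfl
    ext v
    rw [h.2, map_zero]
    rfl
  · rintro rfl
    exact eq_zero_of_ev_eq_zero h.1 h.2.symm

theorem Represents.unique [FiniteDimensional ℝ E] {n : ℕ}
    {x y : ExteriorAlgebra ℝ (Module.Dual ℝ E)} {f : E [⋀^Fin n]→L[ℝ] ℝ} (hx : Represents x f)
    (hy : Represents y f) : x = y := by
  refine sub_eq_zero.mp (eq_zero_of_ev_eq_zero (sub_mem hx.1 hy.1) ?_)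
  rw [map_sub, ← hx.2, ← hy.2, sub_self]

theorem exists_represents [FiniteDimensional ℝ E] {n : ℕ} (f : E [⋀^Fin n]→L[ℝ] ℝ) :
    ∃ x, Represents x f := by
  induction n with
  | zero =>
    refine ⟨algebraMap ℝ _ (f ![]), algebraMap_mem_exteriorPower _, ?_⟩
    ext v
    rw [ev_zero_algebraMap, Subsingleton.elim v ![]]
  | succ n ih =>
    let e := Module.finBasis ℝ E
    choose y hy using fun i => ih (FoliatedPoisson.interior (e i) f)
    -- Euler's identity determines `(n + 1) • x` from the contractions of `x`.
    refine ⟨((n : ℝ) + 1)⁻¹ • ∑ i, ExteriorAlgebra.ι ℝ (e.coord i) * y i,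
      Submodule.smul_mem _ _ (Submodule.sum_mem _ fun i _ => ι_mul_mem _ (hy i).1), ?_⟩
    ext v
    have hn : (n : ℝ) + 1 ≠ 0 := by positivity
    rw [map_smul, map_sum, Pi.smul_apply, Finset.sum_apply, eq_comm, smul_eq_mul,
      inv_mul_eq_iff_eq_mul₀ hn]
    have h1 : ∀ i, ev (n + 1) (ExteriorAlgebra.ι ℝ (e.coord i) * y i) v
        = ∑ j : Fin (n + 1), (-1) ^ (j : ℕ) * (e.coord i (v j) *
          f.toAlternatingMap (Matrix.vecCons (e i) (j.removeNth v))) := by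
      intro i
      rw [ev_ι_mul]
      refine Finset.sum_congr rfl fun j _ => ?_
      rw [← (hy i).2, mul_assoc]
      rfl
    have h2 : ∀ j : Fin (n + 1), ∑ i, e.coord i (v j) *
        f.toAlternatingMap (Matrix.vecCons (e i) (j.removeNth v))
          = f.toAlternatingMap (Matrix.vecCons (v j) (j.removeNth v)) := by
      intro j
      let L : E →ₗ[ℝ] ℝ :=
        { toFun := fun u => f (Matrix.vecCons u (j.removeNth v))
          map_add' := fun u u' => f.vecCons_add _ u u'
          map_smul' := fun c u => f.vecCons_smul _ c u }
      change ∑ i, e.coord i (v j) * L (e i) = L (v j)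
      conv_rhs => rw [← e.sum_repr (v j)]
      rw [map_sum]
      exact Finset.sum_congr rfl fun i _ => by rw [map_smul]; rfl
    simp only [h1]
    rw [Finset.sum_comm]
    have h5 : ∀ j : Fin (n + 1), (-1 : ℝ) ^ (j : ℕ) *
        f.toAlternatingMap (Matrix.vecCons (v j) (j.removeNth v)) = f v := by
      intro j
      have := f.toAlternatingMap.map_insertNth j (v j) (j.removeNth v)
      rw [Fin.insertNth_self_removeNth] at this
      rw [show f v = f.toAlternatingMap v from rfl, this, zsmul_eq_mul]
      simp
    simp only [← Finset.mul_sum, h2, h5]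
    simp

end Iso

/-! ### Consequences of the vanishing of a wedge product -/

section WedgeZero

variable {E : Type*} [AddCommGroup E] [Module ℝ E]

/-- If `x y = 0` with `y ≠ 0`, then `x` vanishes on vectors annihilating `y`: contract the product
with these vectors. -/
theorem ev_eq_zero_of_mul_eq_zero {y : ExteriorAlgebra ℝ (Module.Dual ℝ E)} (hy : y ≠ 0) {p : ℕ}
    {x : ExteriorAlgebra ℝ (Module.Dual ℝ E)} (hx : x ∈ ⋀[ℝ]^p (Module.Dual ℝ E))
    (hxy : x * y = 0) (u : Fin p → E) (hu : ∀ j, ctr (u j) y = 0) : ev p x u = 0 := by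
  induction p generalizing x with
  | zero =>
    obtain ⟨c, rfl⟩ := exists_eq_algebraMap_of_mem hx
    rw [← Algebra.smul_def] at hxy
    rw [ev_zero_algebraMap]
    exact (smul_eq_zero.mp hxy).resolve_right hy
  | succ p ih =>
    refine ih (ctr_mem (u 0) hx) ?_ (Fin.tail u) fun j => hu j.succ
    have h := congrArg (ctr (u 0)) hxy
    rwa [ctr_mul _ hx, hu, mul_zero, smul_zero, add_zero, map_zero] at h

/-- The same statement for a product in the other order. -/
theorem ev_eq_zero_of_mul_eq_zero' {q : ℕ} {y : ExteriorAlgebra ℝ (Module.Dual ℝ E)}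
    (hy : y ≠ 0) (hyq : y ∈ ⋀[ℝ]^q (Module.Dual ℝ E)) {p : ℕ}
    {x : ExteriorAlgebra ℝ (Module.Dual ℝ E)} (hx : x ∈ ⋀[ℝ]^p (Module.Dual ℝ E))
    (hxy : y * x = 0) (u : Fin p → E) (hu : ∀ j, ctr (u j) y = 0) : ev p x u = 0 := by
  induction p generalizing x with
  | zero =>
    obtain ⟨c, rfl⟩ := exists_eq_algebraMap_of_mem hx
    rw [← Algebra.commutes, ← Algebra.smul_def] at hxy
    rw [ev_zero_algebraMap]
    exact (smul_eq_zero.mp hxy).resolve_right hy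
  | succ p ih =>
    refine ih (ctr_mem (u 0) hx) ?_ (Fin.tail u) fun j => hu j.succ
    have h := congrArg (ctr (u 0)) hxy
    rw [ctr_mul _ hyq, hu, zero_mul, zero_add, map_zero] at h
    exact (smul_eq_zero.mp h).resolve_left (by simp)

variable [TopologicalSpace E]

theorem wedgeFamily_apply_eq_zero {k : ℕ} (a : Fin k → E [⋀^Fin 1]→L[ℝ] ℝ) (v : Fin k → E)
    (j : Fin k) (hv : ∀ i, a i ![v j] = 0) : wedgeFamily k a v = 0 := by
  obtain ⟨k, rfl⟩ : ∃ k', k = k' + 1 := ⟨k - 1, by have := j.pos; omega⟩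
  have h := (wedgeFamily (k + 1) a).toAlternatingMap.map_insertNth j (v j) (j.removeNth v)
  rw [Fin.insertNth_self_removeNth] at h
  have h1 : (wedgeFamily (k + 1) a) (Matrix.vecCons (v j) (j.removeNth v)) = 0 := by
    rw [(represents_wedgeFamily a).2, ev_cons, ctr_ιMulti_eq_zero _ _ hv, map_zero]
    rfl
  change (wedgeFamily (k + 1) a).toAlternatingMap v = 0
  rw [h]
  change (-1 : ℤ) ^ (j : ℕ) • (wedgeFamily (k + 1) a) (Matrix.vecCons (v j) (j.removeNth v)) = 0
  rw [h1, smul_zero]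

variable [FiniteDimensional ℝ E]

/-- If `f ∧ a₁ ∧ ⋯ ∧ a_k = 0`, then `f` vanishes on the common kernel of the `a_i`. -/
theorem apply_eq_zero_of_wedge_wedgeFamily {p k : ℕ} (f : E [⋀^Fin p]→L[ℝ] ℝ)
    (a : Fin k → E [⋀^Fin 1]→L[ℝ] ℝ) (ha : wedgeFamily k a ≠ 0)
    (h : wedge f (wedgeFamily k a) = 0) (u : Fin p → E) (hu : ∀ j i, a i ![u j] = 0) :
    f u = 0 := by
  obtain ⟨x, hx⟩ := exists_represents f
  have hy := represents_wedgeFamily a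
  rw [hx.2]
  refine ev_eq_zero_of_mul_eq_zero (fun h0 => ha (hy.eq_zero_iff.mp h0)) hx.1
    ((hx.wedge hy).eq_zero_iff.mpr h) u fun j => ctr_ιMulti_eq_zero _ _ fun i => hu j i

/-- If `X` is dual to `a_j` within the family `a` and `(i_X (a₁ ∧ ⋯ ∧ a_k)) ∧ f = 0`, then `f`
vanishes on the span of `X` and of the common kernel of the `a_i`. -/
theorem apply_eq_zero_of_interior_wedge {p k : ℕ} (f : E [⋀^Fin p]→L[ℝ] ℝ)
    (a : Fin k → E [⋀^Fin 1]→L[ℝ] ℝ) (ha : wedgeFamily k a ≠ 0) (X : E) (j : Fin k)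
    (hX : a j ![X] = 1)
    (h : wedge (interior X (wedgeFamily k a)) f = 0) (u : Fin p → E)
    (hu : ∀ l, u l = X ∨ ∀ i, a i ![u l] = 0) : f u = 0 := by
  obtain ⟨k, rfl⟩ : ∃ k', k = k' + 1 := ⟨k - 1, by have := j.pos; omega⟩
  obtain ⟨x, hx⟩ := exists_represents f
  have hμ := represents_wedgeFamily a
  have hν := hμ.interior X
  rw [hx.2]
  refine ev_eq_zero_of_mul_eq_zero' ?_ hν.1 hx.1 ((hν.wedge hx).eq_zero_iff.mpr h) u ?_
  · intro h0
    have h1 := smul_ιMulti_eq (fun i => covec (a i)) X j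
    rw [h0, mul_zero, covec_apply, hX, one_smul] at h1
    exact ha (hμ.eq_zero_iff.mp h1)
  · intro l
    rcases hu l with hl | hl
    · rw [hl]
      exact CliffordAlgebra.contractLeft_contractLeft (Q := 0) _ _
    · have h2 := CliffordAlgebra.contractLeft_comm (Q := 0) (Module.Dual.eval ℝ E (u l))
        (Module.Dual.eval ℝ E X) (ExteriorAlgebra.ιMulti ℝ (k + 1) fun i => covec (a i))
      have h3 := ctr_ιMulti_eq_zero (fun i => covec (a i)) (u l) hl
      rw [ctr] at h3
      rw [h3, map_zero, neg_zero] at h2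
      exact h2

/-- A vector annihilating `a₁ ∧ ⋯ ∧ a_k` lies in the common kernel of the `a_i`. -/
theorem apply_eq_zero_of_interior_wedgeFamily {k : ℕ} (a : Fin (k + 1) → E [⋀^Fin 1]→L[ℝ] ℝ)
    (ha : wedgeFamily (k + 1) a ≠ 0) (v : E)
    (hv : ∀ w : Fin k → E, wedgeFamily (k + 1) a (Matrix.vecCons v w) = 0) (i : Fin (k + 1)) :
    a i ![v] = 0 := by
  have hμ := represents_wedgeFamily a
  have h0 : ctr v (ExteriorAlgebra.ιMulti ℝ (k + 1) fun i => covec (a i)) = 0 :=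
    (hμ.interior v).eq_zero_iff.mpr (by ext w; exact hv w)
  have h1 := smul_ιMulti_eq (fun i => covec (a i)) v i
  rw [h0, mul_zero] at h1
  exact (smul_eq_zero.mp h1).resolve_right fun h => ha (hμ.eq_zero_iff.mp h)

end WedgeZero

/-! ### The bivector determined by its contraction with a volume form -/

section Contract

variable {E : Type*} [AddCommGroup E] [Module ℝ E]

theorem eq_zero_of_finrank_lt [FiniteDimensional ℝ E] {n : ℕ}
    {x : ExteriorAlgebra ℝ (Module.Dual ℝ E)} (hx : x ∈ ⋀[ℝ]^n (Module.Dual ℝ E))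
    (hn : Module.finrank ℝ E < n) : x = 0 := by
  obtain ⟨f, hf⟩ := exists_coe_eq_ev hx
  refine eq_zero_of_ev_eq_zero hx ?_
  rw [← hf]
  ext v
  refine f.map_linearDependent v fun hv => ?_
  have := hv.fintype_card_le_finrank
  rw [Fintype.card_fin] at this
  omega

/-- A volume element is nondegenerate. -/
theorem eq_zero_of_ctr_volume [FiniteDimensional ℝ E] {x : ExteriorAlgebra ℝ (Module.Dual ℝ E)}
    (hx : x ∈ ⋀[ℝ]^(Module.finrank ℝ E) (Module.Dual ℝ E)) (hx0 : x ≠ 0) {u : E}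
    (hu : ctr u x = 0) : u = 0 := by
  rw [← Module.forall_dual_apply_eq_zero_iff ℝ]
  intro b
  have h := ctr_ι_mul u b x
  rw [eq_zero_of_finrank_lt (ι_mul_mem b hx) (Nat.lt_succ_self _), hu, map_zero, mul_zero,
    sub_zero] at h
  exact (smul_eq_zero.mp h.symm).resolve_right hx0

variable [TopologicalSpace E]

theorem bivector_swap (P : (E →L[ℝ] ℝ) [⋀^Fin 2]→L[ℝ] ℝ) (a b : E →L[ℝ] ℝ) :
    P ![b, a] = -P ![a, b] := by
  have h := P.toAlternatingMap.map_swap ![a, b] (i := 0) (j := 1) (by simp)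
  have h1 : ![a, b] ∘ Equiv.swap 0 1 = ![b, a] := by
    ext i : 1
    fin_cases i <;> simp
  rw [h1] at h
  exact h

variable [IsTopologicalAddGroup E] [ContinuousSMul ℝ E] [T2Space E] [FiniteDimensional ℝ E]

/-- The contraction of an element of the exterior algebra with a bivector. -/
def ctrBivector (P : (E →L[ℝ] ℝ) [⋀^Fin 2]→L[ℝ] ℝ) :
    ExteriorAlgebra ℝ (Module.Dual ℝ E) →ₗ[ℝ] ExteriorAlgebra ℝ (Module.Dual ℝ E) :=
  (2⁻¹ : ℝ) • ∑ i, ∑ j, P ![coframe E i, coframe E j] •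
    (ctr (Module.finBasis ℝ E j) ∘ₗ ctr (Module.finBasis ℝ E i))

theorem ctrBivector_apply (P : (E →L[ℝ] ℝ) [⋀^Fin 2]→L[ℝ] ℝ)
    (x : ExteriorAlgebra ℝ (Module.Dual ℝ E)) :
    ctrBivector P x = (2⁻¹ : ℝ) • ∑ i, ∑ j, P ![coframe E i, coframe E j] •
      ctr (Module.finBasis ℝ E j) (ctr (Module.finBasis ℝ E i) x) := by
  simp [ctrBivector]

theorem Represents.contract (P : (E →L[ℝ] ℝ) [⋀^Fin 2]→L[ℝ] ℝ) {n : ℕ}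
    {x : ExteriorAlgebra ℝ (Module.Dual ℝ E)} {Ω : E [⋀^Fin (n + 2)]→L[ℝ] ℝ}
    (hx : Represents x Ω) : Represents (n := n) (ctrBivector P x) (contract P Ω) := by
  rw [ctrBivector_apply]
  exact (Represents.sum _ fun i => Represents.sum _ fun j =>
    ((hx.interior _).interior _).smul _).smul _

theorem sum_smul_coframe (b : E →L[ℝ] ℝ) :
    ∑ i, b (Module.finBasis ℝ E i) • coframe E i = b := by
  ext v
  have hv := congrArg b ((Module.finBasis ℝ E).sum_repr v)
  rw [map_sum] at hv
  rw [← hv, sum_apply]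
  refine Finset.sum_congr rfl fun i _ => ?_
  simp [coframe, mul_comm]

/-- `i_P (b ∧ x) = i_{P^♯ b} x + b ∧ i_P x`. -/
theorem ctrBivector_ι_mul (P : (E →L[ℝ] ℝ) [⋀^Fin 2]→L[ℝ] ℝ) (b : E →L[ℝ] ℝ)
    (x : ExteriorAlgebra ℝ (Module.Dual ℝ E)) :
    ctrBivector P (ExteriorAlgebra.ι ℝ (b : E →ₗ[ℝ] ℝ) * x)
      = ctr (sharp P b) x + ExteriorAlgebra.ι ℝ (b : E →ₗ[ℝ] ℝ) * ctrBivector P x := by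
  let e := Module.finBasis ℝ E
  have h1 : ∀ j, ∑ i, (P ![coframe E i, coframe E j] * b (e i)) • ctr (e j) x
      = P ![b, coframe E j] • ctr (e j) x := by
    intro j
    rw [← Finset.sum_smul]
    congr 1
    have h := congrArg (fun c => coframe E j (sharp P c)) (sum_smul_coframe b)
    simp only [map_sum, map_smul, smul_eq_mul] at h
    rw [← apply_sharp, ← h]
    refine Finset.sum_congr rfl fun i _ => ?_
    rw [apply_sharp, mul_comm]
  have h2 : ctr (sharp P b) x
      = ∑ i, ∑ j, (P ![coframe E i, coframe E j] * b (e i)) • ctr (e j) x := by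
    rw [Finset.sum_comm, Finset.sum_congr rfl fun j _ => h1 j]
    change ctr (∑ j, P ![b, coframe E j] • e j) x = _
    rw [ctr_sum_left]
    refine Finset.sum_congr rfl fun j _ => ?_
    rw [ctr_smul_left]
  have h3 : ctr (sharp P b) x
      = -∑ i, ∑ j, (P ![coframe E i, coframe E j] * b (e j)) • ctr (e i) x := by
    rw [h2, Finset.sum_comm, ← Finset.sum_neg_distrib]
    refine Finset.sum_congr rfl fun j _ => ?_
    rw [← Finset.sum_neg_distrib]
    refine Finset.sum_congr rfl fun i _ => ?_
    rw [bivector_swap P (coframe E j) (coframe E i), neg_mul, neg_smul]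
  have h4 : ∀ i j, P ![coframe E i, coframe E j] •
        ctr (e j) (ctr (e i) (ExteriorAlgebra.ι ℝ (b : E →ₗ[ℝ] ℝ) * x))
      = (P ![coframe E i, coframe E j] * b (e i)) • ctr (e j) x
        - (P ![coframe E i, coframe E j] * b (e j)) • ctr (e i) x
        + ExteriorAlgebra.ι ℝ (b : E →ₗ[ℝ] ℝ) *
          (P ![coframe E i, coframe E j] • ctr (e j) (ctr (e i) x)) := by
    intro i j
    rw [ctr_ι_mul, map_sub, map_smul, ctr_ι_mul, mul_smul_comm, ← sub_add, smul_add, smul_sub,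
      smul_smul, smul_smul]
    rfl
  rw [ctrBivector_apply, ctrBivector_apply, mul_smul_comm]
  simp only [e] at h2 h3 h4
  simp only [h4, Finset.sum_add_distrib, Finset.sum_sub_distrib, Finset.mul_sum]
  rw [← h2, ← neg_neg (∑ i, ∑ j, (P ![coframe E i, coframe E j] *
    b (Module.finBasis ℝ E j)) • ctr (Module.finBasis ℝ E i) x), ← h3, sub_neg_eq_add, smul_add,
    ← two_smul ℝ (ctr (sharp P b) x), smul_smul, inv_mul_cancel₀ two_ne_zero, one_smul]

/-- In top degree, the contraction with `P` determines the map `P^♯`. -/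
theorem ctr_sharp_volume (P : (E →L[ℝ] ℝ) [⋀^Fin 2]→L[ℝ] ℝ) (b : E →L[ℝ] ℝ)
    {x : ExteriorAlgebra ℝ (Module.Dual ℝ E)}
    (hx : x ∈ ⋀[ℝ]^(Module.finrank ℝ E) (Module.Dual ℝ E)) :
    ctr (sharp P b) x = -(ExteriorAlgebra.ι ℝ (b : E →ₗ[ℝ] ℝ) * ctrBivector P x) := by
  have h := ctrBivector_ι_mul P b x
  rw [eq_zero_of_finrank_lt (ι_mul_mem _ hx) (Nat.lt_succ_self _), map_zero] at h
  exact eq_neg_of_add_eq_zero_left h.symm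

/-- The bivector `P` is tangent to the common kernel `D` of the `a_i`, and is the inverse of the
restriction of `W` to `D`, with the sign given by `W (Z, P^♯ b) = b Z`. -/
structure IsInverseOn {k : ℕ} (a : Fin k → E [⋀^Fin 1]→L[ℝ] ℝ) (W : E [⋀^Fin 2]→L[ℝ] ℝ)
    (P : (E →L[ℝ] ℝ) [⋀^Fin 2]→L[ℝ] ℝ) : Prop where
  apply_sharp_eq_zero : ∀ i b, a i ![sharp P b] = 0
  apply_eq : ∀ Z, (∀ i, a i ![Z] = 0) → ∀ b, W ![Z, sharp P b] = b Z

/-- The case of leaves of dimension zero: here `i_P Ω = 0` forces `P = 0`. -/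
theorem isInverseOn_of_contract_zero {k : ℕ} (a : Fin k → E [⋀^Fin 1]→L[ℝ] ℝ)
    (W : E [⋀^Fin 2]→L[ℝ] ℝ) (P : (E →L[ℝ] ℝ) [⋀^Fin 2]→L[ℝ] ℝ) (hk : Module.finrank ℝ E = k)
    (hΩ : wedge (wedgeFamily k a) (wedgePow W 0) ≠ 0)
    (hP : contract P (wedge (wedgeFamily k a) (wedgePow W 0)) = 0) : IsInverseOn a W P := by
  obtain ⟨w, hw⟩ := exists_represents W
  have hr := (represents_wedgeFamily a).wedge (hw.wedgePow 0)
  have hx0 := fun h => hΩ (hr.eq_zero_iff.mp h)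
  have hx : (ExteriorAlgebra.ιMulti ℝ k fun i => covec (a i)) * w ^ 0
      ∈ ⋀[ℝ]^(Module.finrank ℝ E) (Module.Dual ℝ E) := by
    rw [hk]
    exact hr.1
  have hsharp : ∀ b, sharp P b = 0 := by
    intro b
    rcases Nat.lt_or_ge k 2 with hlt | hge
    · -- In dimension at most one every bivector vanishes.
      rw [← Module.forall_dual_apply_eq_zero_iff ℝ]
      intro c
      have h : P ![b, LinearMap.toContinuousLinearMap c] = 0 := by
        refine P.toAlternatingMap.map_linearDependent _ fun hv => ?_
        have h1 := hv.fintype_card_le_finrank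
        have h2 : Module.finrank ℝ (E →L[ℝ] ℝ) = Module.finrank ℝ E := by
          rw [← LinearMap.toContinuousLinearMap.finrank_eq]
          exact Subspace.dual_finrank_eq
        rw [Fintype.card_fin] at h1
        omega
      rw [← apply_sharp] at h
      exact h
    · obtain ⟨n, rfl⟩ : ∃ n, k = n + 2 := ⟨k - 2, by omega⟩
      refine eq_zero_of_ctr_volume hx hx0 ?_
      rw [ctr_sharp_volume P b hx, (Represents.contract (n := n) P hr).eq_zero_iff.mpr hP,
        mul_zero, neg_zero]
  refine ⟨fun i b => ?_, fun Z hZ b => ?_⟩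
  · rw [hsharp, ← covec_apply, map_zero]
  · have : Z = 0 := by
      refine eq_zero_of_ctr_volume hx hx0 ?_
      rw [pow_zero, mul_one]
      exact ctr_ιMulti_eq_zero _ _ hZ
    rw [hsharp, this, map_zero]
    exact W.map_coord_zero (m := ![0, 0]) 0 rfl

/-- The equation `i_P (μ ∧ W^(r+1)) = (r+1) μ ∧ W^r` says that `P` inverts `W` on the common kernel
of the `a_i`: by `ctr_sharp_volume` it determines `P^♯` on the covectors `a_i`, which are sent to
`0`, and on the covectors `i_Z W` with `Z` in that kernel, which are sent to `-Z`. -/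
theorem isInverseOn_of_contract_eq {k r : ℕ} (a : Fin k → E [⋀^Fin 1]→L[ℝ] ℝ)
    (W : E [⋀^Fin 2]→L[ℝ] ℝ) (P : (E →L[ℝ] ℝ) [⋀^Fin 2]→L[ℝ] ℝ)
    (hk : Module.finrank ℝ E = k + 2 * (r + 1))
    (hΩ : wedge (wedgeFamily k a) (wedgePow W (r + 1)) ≠ 0)
    (hP : contract P (wedge (wedgeFamily k a) (wedgePow W (r + 1)))
      = ((r + 1 : ℕ) : ℝ) • wedge (wedgeFamily k a) (wedgePow W r)) : IsInverseOn a W P := by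
  obtain ⟨w, hw⟩ := exists_represents W
  have hμ := represents_wedgeFamily a
  have hr := hμ.wedge (hw.wedgePow (r + 1))
  have hσ := (hμ.wedge (hw.wedgePow r)).smul ((r + 1 : ℕ) : ℝ)
  set μ := ExteriorAlgebra.ιMulti ℝ k fun i => covec (a i) with hμdef
  have hx0 := fun h => hΩ (hr.eq_zero_iff.mp h)
  have hx : μ * w ^ (r + 1) ∈ ⋀[ℝ]^(Module.finrank ℝ E) (Module.Dual ℝ E) := by
    rw [hk]
    exact hr.1
  have hc : ctrBivector P (μ * w ^ (r + 1)) = ((r + 1 : ℕ) : ℝ) • (μ * w ^ r) := by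
    have h := Represents.contract (n := k + 2 * r) P hr
    rw [hP] at h
    exact h.unique hσ
  have hsharp : ∀ b, ctr (sharp P b) (μ * w ^ (r + 1))
      = -(((r + 1 : ℕ) : ℝ) • (ExteriorAlgebra.ι ℝ (b : E →ₗ[ℝ] ℝ) * (μ * w ^ r))) := by
    intro b
    rw [ctr_sharp_volume P b hx, hc, mul_smul_comm]
  refine ⟨fun i b => ?_, fun Z hZ b => ?_⟩
  · have h0 : sharp P (LinearMap.toContinuousLinearMap (covec (a i))) = 0 := by
      refine eq_zero_of_ctr_volume hx hx0 ?_
      rw [hsharp, LinearMap.coe_toContinuousLinearMap, ← mul_assoc,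
        ι_mul_ιMulti_self (fun i => covec (a i)) i, zero_mul, smul_zero, neg_zero]
    have h1 := apply_sharp P b (LinearMap.toContinuousLinearMap (covec (a i)))
    rw [bivector_swap, ← apply_sharp, h0, map_zero, neg_zero] at h1
    exact h1
  · set c := covec (interior Z W)
    have h0 : sharp P (LinearMap.toContinuousLinearMap c) = -Z := by
      rw [eq_neg_iff_add_eq_zero]
      refine eq_zero_of_ctr_volume hx hx0 ?_
      rw [ctr_add_left, hsharp, LinearMap.coe_toContinuousLinearMap, ctr_mul _ hμ.1,
        ctr_ιMulti_eq_zero _ _ hZ, zero_mul, zero_add, ctr_pow_succ hw.1, hw.ctr_eq_ι,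
        ← mul_assoc, ι_mul_comm _ hμ.1, mul_smul_comm, smul_comm, smul_mul_assoc, mul_assoc,
        neg_add_eq_zero]
    have h1 := apply_sharp P b (LinearMap.toContinuousLinearMap c)
    rw [bivector_swap, ← apply_sharp, h0, map_neg, neg_neg] at h1
    exact h1

end Contract

/-! ### Derivatives of forms and of bivector fields on a vector space -/

section Flat

open Filter Topology

variable {E : Type*} [NormedAddCommGroup E] [NormedSpace ℝ E]

theorem fderiv_apply_vecCons {n : ℕ} {f : E → E [⋀^Fin (n + 1)]→L[ℝ] ℝ} {X : E → E} {y : E}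
    (hf : DifferentiableAt ℝ f y) (hX : DifferentiableAt ℝ X y) (w : Fin n → E) (u : E) :
    fderiv ℝ (fun z => f z (Matrix.vecCons (X z) w)) y u
      = fderiv ℝ f y u (Matrix.vecCons (X y) w)
        + f y (Matrix.vecCons (fderiv ℝ X y u) w) := by
  let g : Fin (n + 1) → E → E := Fin.cons X fun i _ => w i
  have hg : ∀ i, DifferentiableAt ℝ (g i) y := by
    refine Fin.cases hX fun i => ?_
    exact differentiableAt_const _
  have hgz : ∀ z, (fun i => g i z) = Matrix.vecCons (X z) w := by
    intro z
    ext i : 1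
    refine Fin.cases rfl (fun i => rfl) i
  have h := fderiv_continuousAlternatingMap_apply_apply hf hg u
  simp only [hgz] at h
  rw [h, Fin.sum_univ_succ]
  congr 1
  rw [Finset.sum_eq_zero, add_zero]
  · congr 1
    ext i : 1
    refine Fin.cases ?_ (fun i => ?_) i
    · rw [Function.update_self]
      rfl
    · rw [Function.update_of_ne (Fin.succ_ne_zero i)]
      rfl
  · intro i _
    refine (f y).map_coord_zero i.succ ?_
    rw [Function.update_self]
    change fderiv ℝ (fun _ => w i) y u = 0
    simp

theorem fderiv_apply_one {f : E → E [⋀^Fin 1]→L[ℝ] ℝ} {X : E → E} {y : E}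
    (hf : DifferentiableAt ℝ f y) (hX : DifferentiableAt ℝ X y) (u : E) :
    fderiv ℝ (fun z => f z ![X z]) y u
      = fderiv ℝ f y u ![X y] + f y ![fderiv ℝ X y u] :=
  fderiv_apply_vecCons hf hX _ u

theorem fderiv_apply_two {f : E → E [⋀^Fin 2]→L[ℝ] ℝ} {X Y : E → E} {y : E}
    (hf : DifferentiableAt ℝ f y) (hX : DifferentiableAt ℝ X y) (hY : DifferentiableAt ℝ Y y)
    (u : E) :
    fderiv ℝ (fun z => f z ![X z, Y z]) y u
      = fderiv ℝ f y u ![X y, Y y] + f y ![fderiv ℝ X y u, Y y]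
        + f y ![X y, fderiv ℝ Y y u] := by
  have hg : ∀ i, DifferentiableAt ℝ (![X, Y] i) y := by
    intro i
    fin_cases i
    · exact hX
    · exact hY
  have hgz : ∀ z, (fun i => (![X, Y] : Fin 2 → E → E) i z) = ![X z, Y z] := by
    intro z
    ext i : 1
    fin_cases i <;> rfl
  have h := fderiv_continuousAlternatingMap_apply_apply hf hg u
  simp only [hgz] at h
  rw [h, Fin.sum_univ_two, ← add_assoc]
  congr 3
  · ext i : 1
    fin_cases i <;> simp
  · ext i : 1
    fin_cases i <;> simp

theorem extDeriv_apply' {n : ℕ} (f : E → E [⋀^Fin n]→L[ℝ] ℝ) (y : E) (v : Fin (n + 1) → E) :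
    extDeriv f y v = ∑ i : Fin (n + 1), (-1) ^ (i : ℕ) * fderiv ℝ f y (v i) (i.removeNth v) := by
  rw [extDeriv, ContinuousAlternatingMap.alternatizeUncurryFin_apply]
  simp

theorem extDeriv_apply_one (f : E → E [⋀^Fin 1]→L[ℝ] ℝ) (y u v : E) :
    extDeriv f y ![u, v] = fderiv ℝ f y u ![v] - fderiv ℝ f y v ![u] := by
  rw [extDeriv_apply', Fin.sum_univ_two]
  have h0 : Fin.removeNth 0 ![u, v] = ![v] := by
    ext i : 1; fin_cases i; rfl
  have h1 : Fin.removeNth 1 ![u, v] = ![u] := by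
    ext i : 1; fin_cases i; rfl
  rw [h0, h1]
  simp
  ring

theorem extDeriv_apply_two (f : E → E [⋀^Fin 2]→L[ℝ] ℝ) (y u v w : E) :
    extDeriv f y ![u, v, w] = fderiv ℝ f y u ![v, w] - fderiv ℝ f y v ![u, w]
      + fderiv ℝ f y w ![u, v] := by
  rw [extDeriv_apply', Fin.sum_univ_three]
  have h0 : Fin.removeNth 0 ![u, v, w] = ![v, w] := by
    ext i : 1; fin_cases i <;> rfl
  have h1 : Fin.removeNth 1 ![u, v, w] = ![u, w] := by
    ext i : 1; fin_cases i <;> rfl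
  have h2 : Fin.removeNth 2 ![u, v, w] = ![u, v] := by
    ext i : 1; fin_cases i <;> rfl
  rw [h0, h1, h2]
  simp
  ring

theorem twoForm_swap (f : E [⋀^Fin 2]→L[ℝ] ℝ) (u v : E) : f ![v, u] = -f ![u, v] := by
  have h := f.toAlternatingMap.map_swap ![u, v] (i := 0) (j := 1) (by simp)
  have h1 : ![u, v] ∘ Equiv.swap 0 1 = ![v, u] := by
    ext i : 1
    fin_cases i <;> simp
  rw [h1] at h
  exact h

theorem twoForm_sub_left (f : E [⋀^Fin 2]→L[ℝ] ℝ) (u v w : E) :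
    f ![u - v, w] = f ![u, w] - f ![v, w] := by
  have h := f.vecCons_add ![w] (u - v) v
  rw [sub_add_cancel] at h
  exact eq_sub_of_add_eq h.symm

theorem oneForm_sub (f : E [⋀^Fin 1]→L[ℝ] ℝ) (u v : E) : f ![u - v] = f ![u] - f ![v] := by
  have h := f.vecCons_add ![] (u - v) v
  rw [sub_add_cancel] at h
  exact eq_sub_of_add_eq h.symm

theorem differentiableAt_bivector_apply {P : E → (E →L[ℝ] ℝ) [⋀^Fin 2]→L[ℝ] ℝ} {y : E}
    (hP : DifferentiableAt ℝ P y) (v : Fin 2 → (E →L[ℝ] ℝ)) :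
    DifferentiableAt ℝ (fun z => P z v) y :=
  hP.continuousAlternatingMap_apply fun _ => differentiableAt_const _

variable [FiniteDimensional ℝ E]

theorem differentiableAt_sharp {P : E → (E →L[ℝ] ℝ) [⋀^Fin 2]→L[ℝ] ℝ} {y : E}
    (hP : DifferentiableAt ℝ P y) (a : E →L[ℝ] ℝ) :
    DifferentiableAt ℝ (fun z => sharp (P z) a) y := by
  change DifferentiableAt ℝ (fun z => ∑ i, P z ![a, coframe E i] • Module.finBasis ℝ E i) y
  refine DifferentiableAt.fun_sum fun i _ => ?_
  exact (differentiableAt_bivector_apply hP _).smul_const _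

theorem apply_fderiv_sharp {P : E → (E →L[ℝ] ℝ) [⋀^Fin 2]→L[ℝ] ℝ} {y : E}
    (hP : DifferentiableAt ℝ P y) (a b : E →L[ℝ] ℝ) (u : E) :
    b (fderiv ℝ (fun z => sharp (P z) a) y u) = fderiv ℝ (fun z => P z ![a, b]) y u := by
  have h : (fun z => P z ![a, b]) = b ∘ fun z => sharp (P z) a := by
    ext z
    exact (apply_sharp _ _ _).symm
  rw [h, fderiv_comp y b.differentiableAt (differentiableAt_sharp hP a), b.fderiv]
  rfl

/-- Coordinate expressions at a point `y` of the 1-forms, the 2-form and the bivector field: they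
are differentiable at `y`, the bivector is inverse to the 2-form along the leaves near `y`, and
the 1-forms are closed along the leaves at `y`. -/
structure IsInverseNear {k : ℕ} (A : Fin k → E → E [⋀^Fin 1]→L[ℝ] ℝ) (W : E → E [⋀^Fin 2]→L[ℝ] ℝ)
    (P : E → (E →L[ℝ] ℝ) [⋀^Fin 2]→L[ℝ] ℝ) (y : E) : Prop where
  diff_A : ∀ i, DifferentiableAt ℝ (A i) y
  diff_W : DifferentiableAt ℝ W y
  diff_P : DifferentiableAt ℝ P y
  inverse : ∀ᶠ z in 𝓝 y, IsInverseOn (fun i => A i z) (W z) (P z)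
  extDeriv_A : ∀ u v, (∀ i, A i y ![u] = 0) → (∀ i, A i y ![v] = 0) →
    ∀ i, extDeriv (A i) y ![u, v] = 0

variable {k : ℕ} {A : Fin k → E → E [⋀^Fin 1]→L[ℝ] ℝ} {W : E → E [⋀^Fin 2]→L[ℝ] ℝ}
    {P : E → (E →L[ℝ] ℝ) [⋀^Fin 2]→L[ℝ] ℝ} {y : E}

/-- The field `P^♯ a` is tangent to the leaves near `y`. -/
theorem IsInverseNear.deriv_A (h : IsInverseNear A W P y) (i : Fin k) (a : E →L[ℝ] ℝ) (u : E) :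
    fderiv ℝ (A i) y u ![sharp (P y) a]
      + A i y ![fderiv ℝ (fun z => sharp (P z) a) y u] = 0 := by
  rw [← fderiv_apply_one (h.diff_A i) (differentiableAt_sharp h.diff_P a)]
  have h0 : (fun z => A i z ![sharp (P z) a]) =ᶠ[𝓝 y] fun _ => 0 :=
    h.inverse.mono fun z hz => hz.apply_sharp_eq_zero i a
  rw [h0.fderiv_eq]
  simp

/-- The derivative of the identity `W (P^♯ a, P^♯ b) = P (a, b)`. -/
theorem IsInverseNear.deriv_W (h : IsInverseNear A W P y) (a b : E →L[ℝ] ℝ) (u : E) :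
    fderiv ℝ (fun z => P z ![a, b]) y u = fderiv ℝ W y u ![sharp (P y) a, sharp (P y) b]
      + W y ![fderiv ℝ (fun z => sharp (P z) a) y u, sharp (P y) b]
      + W y ![sharp (P y) a, fderiv ℝ (fun z => sharp (P z) b) y u] := by
  rw [← fderiv_apply_two h.diff_W (differentiableAt_sharp h.diff_P a)
    (differentiableAt_sharp h.diff_P b)]
  have h0 : (fun z => P z ![a, b]) =ᶠ[𝓝 y] fun z => W z ![sharp (P z) a, sharp (P z) b] :=
    h.inverse.mono fun z hz => by
      change P z ![a, b] = W z ![sharp (P z) a, sharp (P z) b]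
      rw [hz.apply_eq _ (fun i => hz.apply_sharp_eq_zero i a), apply_sharp]
  rw [h0.fderiv_eq]

/-- A bivector inverse along the leaves to a 2-form closed along the leaves satisfies the Jacobi
identity. -/
theorem IsInverseNear.schoutenSelf_eq_zero (h : IsInverseNear A W P y)
    (hW : ∀ u v w, (∀ i, A i y ![u] = 0) → (∀ i, A i y ![v] = 0) → (∀ i, A i y ![w] = 0) →
      extDeriv W y ![u, v, w] = 0) (a b c : E →L[ℝ] ℝ) :
    schoutenSelf P y a b c = 0 := by
  have hinv := h.inverse.self_of_nhds
  -- The brackets of the fields `P^♯ a` are tangent to the leaves.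
  have hbr : ∀ a b c : E →L[ℝ] ℝ,
      W y ![fderiv ℝ (fun z => sharp (P z) b) y (sharp (P y) a)
        - fderiv ℝ (fun z => sharp (P z) a) y (sharp (P y) b), sharp (P y) c]
      = fderiv ℝ (fun z => P z ![b, c]) y (sharp (P y) a)
        - fderiv ℝ (fun z => P z ![a, c]) y (sharp (P y) b) := by
    intro a b c
    rw [hinv.apply_eq, map_sub, apply_fderiv_sharp h.diff_P, apply_fderiv_sharp h.diff_P]
    intro i
    have h1 := h.deriv_A i b (sharp (P y) a)
    have h2 := h.deriv_A i a (sharp (P y) b)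
    have h3 := h.extDeriv_A _ _ (fun i => hinv.apply_sharp_eq_zero i a)
      (fun i => hinv.apply_sharp_eq_zero i b) i
    rw [extDeriv_apply_one] at h3
    rw [oneForm_sub]
    linarith
  have hd := hW _ _ _ (fun i => hinv.apply_sharp_eq_zero i a)
    (fun i => hinv.apply_sharp_eq_zero i b) (fun i => hinv.apply_sharp_eq_zero i c)
  rw [extDeriv_apply_two] at hd
  have e1 := h.deriv_W b c (sharp (P y) a)
  have e2 := h.deriv_W c a (sharp (P y) b)
  have e3 := h.deriv_W a b (sharp (P y) c)
  have b1 := hbr a b c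
  have b2 := hbr b c a
  have b3 := hbr c a b
  rw [twoForm_sub_left] at b1 b2 b3
  have hsw : ∀ a b : E →L[ℝ] ℝ, ∀ u, fderiv ℝ (fun z => P z ![b, a]) y u
      = -fderiv ℝ (fun z => P z ![a, b]) y u := by
    intro a b u
    have : (fun z => P z ![b, a]) = fun z => -(P z ![a, b]) := by
      ext z
      exact bivector_swap (P z) a b
    rw [this, fderiv_fun_neg]
    rfl
  rw [hsw c a] at b1
  rw [hsw a b] at b2
  rw [hsw b c] at b3
  have s1 := twoForm_swap (fderiv ℝ W y (sharp (P y) b)) (sharp (P y) a) (sharp (P y) c)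
  have t1 := twoForm_swap (W y) (sharp (P y) a)
    (fderiv ℝ (fun z => sharp (P z) b) y (sharp (P y) c))
  have t2 := twoForm_swap (W y) (sharp (P y) b)
    (fderiv ℝ (fun z => sharp (P z) c) y (sharp (P y) a))
  have t3 := twoForm_swap (W y) (sharp (P y) c)
    (fderiv ℝ (fun z => sharp (P z) a) y (sharp (P y) b))
  rw [schoutenSelf]
  linarith

/-- A vector field `X` with `i_X W = 0` and `dW (X, ·, ·) = 0` along the leaves, whose brackets with
the fields `P^♯ a` are tangent to the leaves, preserves the bivector. -/
theorem IsInverseNear.schoutenVec_eq_zero (h : IsInverseNear A W P y) {X : E → E}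
    (hX : DifferentiableAt ℝ X y) (hXW : ∀ᶠ z in 𝓝 y, ∀ v, W z ![X z, v] = 0)
    (hW : ∀ u v, (∀ i, A i y ![u] = 0) → (∀ i, A i y ![v] = 0) →
      extDeriv W y ![X y, u, v] = 0)
    (hXA : ∀ (a : E →L[ℝ] ℝ) (i : Fin k), A i y ![fderiv ℝ (fun z => sharp (P z) a) y (X y)
      - fderiv ℝ X y (sharp (P y) a)] = 0) (a b : E →L[ℝ] ℝ) :
    schoutenVec X P y a b = 0 := by
  have hinv := h.inverse.self_of_nhds
  have hdX : ∀ u v, fderiv ℝ W y u ![X y, v] + W y ![fderiv ℝ X y u, v] = 0 := by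
    intro u v
    rw [← fderiv_apply_vecCons h.diff_W hX]
    have h0 : (fun z => W z ![X z, v]) =ᶠ[𝓝 y] fun _ => 0 := hXW.mono fun z hz => hz v
    rw [h0.fderiv_eq]
    simp
  have hbr : ∀ a b : E →L[ℝ] ℝ,
      W y ![fderiv ℝ (fun z => sharp (P z) a) y (X y) - fderiv ℝ X y (sharp (P y) a),
        sharp (P y) b]
      = fderiv ℝ (fun z => P z ![a, b]) y (X y) - P y ![a, b ∘L fderiv ℝ X y] := by
    intro a b
    rw [hinv.apply_eq _ (hXA a), map_sub, apply_fderiv_sharp h.diff_P, ← apply_sharp]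
    rfl
  have hd := hW _ _ (fun i => hinv.apply_sharp_eq_zero i a) (fun i => hinv.apply_sharp_eq_zero i b)
  rw [extDeriv_apply_two] at hd
  have e1 := h.deriv_W a b (X y)
  have b1 := hbr a b
  have b2 := hbr b a
  rw [twoForm_sub_left] at b1 b2
  have x1 := hdX (sharp (P y) a) (sharp (P y) b)
  have x2 := hdX (sharp (P y) b) (sharp (P y) a)
  have t1 := twoForm_swap (W y) (sharp (P y) a) (fderiv ℝ (fun z => sharp (P z) b) y (X y))
  have p1 := bivector_swap (P y) b (a ∘L fderiv ℝ X y)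
  have hsw : fderiv ℝ (fun z => P z ![b, a]) y (X y)
      = -fderiv ℝ (fun z => P z ![a, b]) y (X y) := by
    have : (fun z => P z ![b, a]) = fun z => -(P z ![a, b]) := by
      ext z
      exact bivector_swap (P z) a b
    rw [this, fderiv_fun_neg]
    rfl
  rw [hsw] at b2
  rw [schoutenVec]
  linarith

end Flat

/-! ### Differentiability of wedge products, and the Lie derivative of a form -/

section Lie

open Filter Topology

variable {E : Type*} [NormedAddCommGroup E] [NormedSpace ℝ E]

theorem differentiableAt_interior {n : ℕ} {f : E → E [⋀^Fin (n + 1)]→L[ℝ] ℝ} {X : E → E} {y : E}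
    (hf : DifferentiableAt ℝ f y) (hX : DifferentiableAt ℝ X y) :
    DifferentiableAt ℝ (fun z => (interior (X z) (f z) : E [⋀^Fin n]→L[ℝ] ℝ)) y := by
  let L := (ContinuousAlternatingMap.curryLeftLI (𝕜 := ℝ) (E := E) (F := ℝ)
    (n := n)).toContinuousLinearMap
  have h : DifferentiableAt ℝ (fun z => L (f z) (X z)) y := by fun_prop
  exact h

/-- Cartan's expression of the Lie derivative, evaluated on constant vectors. -/
theorem extDeriv_interior_add_interior_extDeriv {n : ℕ} {f : E → E [⋀^Fin (n + 1)]→L[ℝ] ℝ}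
    {X : E → E} {y : E} (hf : DifferentiableAt ℝ f y) (hX : DifferentiableAt ℝ X y)
    (v : Fin (n + 1) → E) :
    extDeriv (fun z => (interior (X z) (f z) : E [⋀^Fin n]→L[ℝ] ℝ)) y v
      + extDeriv f y (Matrix.vecCons (X y) v)
      = fderiv ℝ f y (X y) v + ∑ i : Fin (n + 1), (-1) ^ (i : ℕ) *
        f y (Matrix.vecCons (fderiv ℝ X y (v i)) (i.removeNth v)) := by
  have h1 : ∀ (u : E) (w : Fin n → E),
      fderiv ℝ (fun z => (interior (X z) (f z) : E [⋀^Fin n]→L[ℝ] ℝ)) y u w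
      = fderiv ℝ f y u (Matrix.vecCons (X y) w) + f y (Matrix.vecCons (fderiv ℝ X y u) w) := by
    intro u w
    rw [← fderiv_apply_vecCons hf hX, ← fderiv_continuousAlternatingMap_apply_const_apply
      (differentiableAt_interior hf hX)]
    rfl
  have h2 : Fin.removeNth 0 (Matrix.vecCons (X y) v) = v := rfl
  have h3 : ∀ i : Fin (n + 1), Fin.removeNth i.succ (Matrix.vecCons (X y) v)
      = Matrix.vecCons (X y) (i.removeNth v) := by
    intro i
    ext j : 1
    refine Fin.cases ?_ (fun j => ?_) j
    · simp [Fin.removeNth]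
    · simp [Fin.removeNth]
  have e1 : extDeriv (fun z => (interior (X z) (f z) : E [⋀^Fin n]→L[ℝ] ℝ)) y v
      = ∑ i : Fin (n + 1), (-1) ^ (i : ℕ) * fderiv ℝ f y (v i)
          (Matrix.vecCons (X y) (i.removeNth v))
        + ∑ i : Fin (n + 1), (-1) ^ (i : ℕ) *
          f y (Matrix.vecCons (fderiv ℝ X y (v i)) (i.removeNth v)) := by
    rw [extDeriv_apply' (n := n), ← Finset.sum_add_distrib]
    refine Finset.sum_congr rfl fun i _ => ?_
    rw [← mul_add]
    exact congrArg _ (h1 _ _)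
  have e2 : extDeriv f y (Matrix.vecCons (X y) v) = fderiv ℝ f y (X y) v
      - ∑ i : Fin (n + 1), (-1) ^ (i : ℕ) * fderiv ℝ f y (v i)
          (Matrix.vecCons (X y) (i.removeNth v)) := by
    rw [extDeriv_apply', Fin.sum_univ_succ, sub_eq_add_neg, ← Finset.sum_neg_distrib, h2]
    congr 1
    · simp
    · refine Finset.sum_congr rfl fun i _ => ?_
      rw [h3, Fin.val_succ, pow_succ, Matrix.cons_val_succ]
      ring
  rw [e1, e2]
  ring

variable [FiniteDimensional ℝ E]

instance instFiniteDimensionalForm (n : ℕ) : FiniteDimensional ℝ (E [⋀^Fin n]→L[ℝ] ℝ) :=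
  FiniteDimensional.of_injective
    ((AlternatingMap.toMultilinearMapLM (S := ℝ)).comp
      (ContinuousAlternatingMap.toAlternatingMapLinear (R := ℝ) :
        (E [⋀^Fin n]→L[ℝ] ℝ) →ₗ[ℝ] (E [⋀^Fin n]→ₗ[ℝ] ℝ)))
    fun f g h => by
      ext v
      exact congrArg (fun F : MultilinearMap ℝ (fun _ : Fin n => E) ℝ => F v) h

/-- The wedge product as a continuous bilinear map. -/
def wedgeL (p q : ℕ) :
    (E [⋀^Fin p]→L[ℝ] ℝ) →L[ℝ] (E [⋀^Fin q]→L[ℝ] ℝ) →L[ℝ] (E [⋀^Fin (p + q)]→L[ℝ] ℝ) :=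
  (LinearMap.mk₂ ℝ wedge
    (fun f f' g => by
      ext v
      exact congrArg (fun F => F v)
        (algWedge_add_left f.toAlternatingMap f'.toAlternatingMap g.toAlternatingMap))
    (fun c f g => by
      ext v
      exact congrArg (fun F => F v) (algWedge_smul_left c f.toAlternatingMap g.toAlternatingMap))
    (fun f g g' => by
      ext v
      exact congrArg (fun F => F v)
        (algWedge_add_right f.toAlternatingMap g.toAlternatingMap g'.toAlternatingMap))
    (fun c f g => by
      ext v
      exact congrArg (fun F => F v)
        (algWedge_smul_right c f.toAlternatingMap g.toAlternatingMap))).toContinuousBilinearMap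

theorem differentiableAt_wedgeFamily {y : E} : ∀ {k : ℕ} {A : Fin k → E → E [⋀^Fin 1]→L[ℝ] ℝ},
    (∀ i, DifferentiableAt ℝ (A i) y) →
      DifferentiableAt ℝ (fun z => wedgeFamily k fun i => A i z) y
  | 0, _, _ => differentiableAt_const _
  | k + 1, A, hA => by
    have h1 := differentiableAt_wedgeFamily fun i : Fin k => hA i.castSucc
    have h2 := hA (Fin.last k)
    have h : DifferentiableAt ℝ
        (fun z => wedgeL k 1 (wedgeFamily k fun i => A i.castSucc z) (A (Fin.last k) z)) y := by
      fun_prop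
    exact h

variable {k : ℕ} {W : E → E [⋀^Fin 2]→L[ℝ] ℝ} {P : E → (E →L[ℝ] ℝ) [⋀^Fin 2]→L[ℝ] ℝ} {y : E}

/-- If `i_Z (L_X (α₁ ∧ ⋯ ∧ α_k)) = 0` for all vectors `Z = P^♯ a` at the point `y`, then the bracket
of `X` with the fields `P^♯ a` is tangent to the leaves at `y`. -/
theorem IsInverseNear.bracket_tangent {A : Fin (k + 1) → E → E [⋀^Fin 1]→L[ℝ] ℝ}
    (h : IsInverseNear A W P y) {X : E → E} (hX : DifferentiableAt ℝ X y)
    (hμ : wedgeFamily (k + 1) (fun i => A i y) ≠ 0) (a : E →L[ℝ] ℝ)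
    (hL : ∀ w : Fin k → E,
      extDeriv (fun z => (interior (X z) (wedgeFamily (k + 1) fun i => A i z) :
          E [⋀^Fin k]→L[ℝ] ℝ)) y (Matrix.vecCons (sharp (P y) a) w)
        + extDeriv (fun z => wedgeFamily (k + 1) fun i => A i z) y
          (Matrix.vecCons (X y) (Matrix.vecCons (sharp (P y) a) w)) = 0)
    (i : Fin (k + 1)) :
    A i y ![fderiv ℝ (fun z => sharp (P z) a) y (X y) - fderiv ℝ X y (sharp (P y) a)] = 0 := by
  have hdμ := differentiableAt_wedgeFamily h.diff_A
  have hZ := h.inverse.self_of_nhds.apply_sharp_eq_zero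
  refine apply_eq_zero_of_interior_wedgeFamily (fun i => A i y) hμ _ (fun w => ?_) i
  have h1 := hL w
  rw [extDeriv_interior_add_interior_extDeriv hdμ hX, Fin.sum_univ_succ] at h1
  -- In the remaining terms of the sum `P^♯ a` is one of the arguments.
  rw [Finset.sum_eq_zero (s := Finset.univ) (f := fun i : Fin k => _), add_zero] at h1
  · have h2 := fderiv_apply_vecCons hdμ (differentiableAt_sharp h.diff_P a) w (X y)
    have h3 : (fun z => wedgeFamily (k + 1) (fun i => A i z) (Matrix.vecCons (sharp (P z) a) w))
        =ᶠ[𝓝 y] fun _ => 0 :=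
      h.inverse.mono fun z hz =>
        wedgeFamily_apply_eq_zero _ _ 0 fun i => hz.apply_sharp_eq_zero i a
    rw [h3.fderiv_eq] at h2
    have h4 := (wedgeFamily (k + 1) fun i => A i y).vecCons_add w
      (fderiv ℝ (fun z => sharp (P z) a) y (X y) - fderiv ℝ X y (sharp (P y) a))
      (fderiv ℝ X y (sharp (P y) a))
    rw [sub_add_cancel] at h4
    have h5 : Fin.removeNth 0 (Matrix.vecCons (sharp (P y) a) w) = w := rfl
    simp only [h5, Fin.val_zero, pow_zero, one_mul, Matrix.cons_val_zero, fderiv_fun_const,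
      Pi.zero_apply, zero_apply] at h1 h2
    linarith
  · intro j _
    obtain ⟨k, rfl⟩ : ∃ k', k = k' + 1 := ⟨k - 1, by have := j.pos; omega⟩
    rw [wedgeFamily_apply_eq_zero _ _ (Fin.succ 0), mul_zero]
    intro i
    simpa [Fin.removeNth] using hZ i a

end Lie

/-! ### Behaviour under linear isomorphisms -/

theorem comp_vecCons {E F : Type*} {n : ℕ} (L : E → F) (u : E) (v : Fin n → E) :
    L ∘ Matrix.vecCons u v = Matrix.vecCons (L u) (L ∘ v) := by
  ext i : 1
  refine Fin.cases rfl (fun i => rfl) i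

section Transport

variable {E F : Type*} [AddCommGroup E] [Module ℝ E] [TopologicalSpace E]
  [AddCommGroup F] [Module ℝ F] [TopologicalSpace F]

theorem wedge_compContinuousLinearMap {p q : ℕ} (f : F [⋀^Fin p]→L[ℝ] ℝ) (g : F [⋀^Fin q]→L[ℝ] ℝ)
    (L : E →L[ℝ] F) : (wedge f g).compContinuousLinearMap L
      = wedge (f.compContinuousLinearMap L) (g.compContinuousLinearMap L) := by
  ext v
  change LinearMap.mul' ℝ ℝ ((f.toAlternatingMap.domCoprod g.toAlternatingMap)
      ((L ∘ v) ∘ finSumFinEquiv))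
    = LinearMap.mul' ℝ ℝ (((f.compContinuousLinearMap L).toAlternatingMap.domCoprod
      (g.compContinuousLinearMap L).toAlternatingMap) (v ∘ finSumFinEquiv))
  simp only [AlternatingMap.domCoprod_apply, sum_apply, map_sum]
  refine Finset.sum_congr rfl fun σ _ => ?_
  induction σ using Quotient.inductionOn' with
  | h σ =>
    rw [AlternatingMap.domCoprod.summand_mk'', AlternatingMap.domCoprod.summand_mk'']
    rfl

theorem wedgeFamily_compContinuousLinearMap (L : E →L[ℝ] F) :
    ∀ {k : ℕ} (a : Fin k → F [⋀^Fin 1]→L[ℝ] ℝ), (wedgeFamily k a).compContinuousLinearMap L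
      = wedgeFamily k fun i => (a i).compContinuousLinearMap L
  | 0, _ => rfl
  | k + 1, a => by
    rw [wedgeFamily, wedgeFamily, wedge_compContinuousLinearMap,
      wedgeFamily_compContinuousLinearMap]

theorem compContinuousLinearMap_vec1 (f : F [⋀^Fin 1]→L[ℝ] ℝ) (L : E →L[ℝ] F) (u : E) :
    f.compContinuousLinearMap L ![u] = f ![L u] := by
  rw [ContinuousAlternatingMap.compContinuousLinearMap_apply]
  congr 1
  ext i : 1
  fin_cases i
  rfl

variable [IsTopologicalAddGroup E] [ContinuousSMul ℝ E] [T2Space E] [FiniteDimensional ℝ E]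
  [IsTopologicalAddGroup F] [ContinuousSMul ℝ F] [T2Space F] [FiniteDimensional ℝ F]

theorem sharp_compContinuousLinearMap (P : (F →L[ℝ] ℝ) [⋀^Fin 2]→L[ℝ] ℝ) (D : F →L[ℝ] E)
    (b : E →L[ℝ] ℝ) :
    sharp (P.compContinuousLinearMap (ContinuousLinearMap.precomp ℝ D)) b
      = D (sharp P (b ∘L D)) := by
  rw [← sub_eq_zero, ← Module.forall_dual_apply_eq_zero_iff ℝ]
  intro c
  rw [map_sub, sub_eq_zero]
  have h := apply_sharp (P.compContinuousLinearMap (ContinuousLinearMap.precomp ℝ D)) b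
    (LinearMap.toContinuousLinearMap c)
  refine h.trans ?_
  change _ = (LinearMap.toContinuousLinearMap c ∘L D) (sharp P (b ∘L D))
  rw [apply_sharp, ContinuousAlternatingMap.compContinuousLinearMap_apply, comp_vecCons,
    comp_vecCons, Subsingleton.elim (_ ∘ _) ![]]
  rfl

/-- The relation between `W` and `P` is invariant under a linear isomorphism `L` with inverse `D`. -/
theorem IsInverseOn.transport {k : ℕ} {a : Fin k → F [⋀^Fin 1]→L[ℝ] ℝ} {W : F [⋀^Fin 2]→L[ℝ] ℝ}
    {P : (F →L[ℝ] ℝ) [⋀^Fin 2]→L[ℝ] ℝ} (h : IsInverseOn a W P) (L : E →L[ℝ] F) (D : F →L[ℝ] E)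
    (hDL : ∀ v, D (L v) = v) (hLD : ∀ v, L (D v) = v) :
    IsInverseOn (fun i => (a i).compContinuousLinearMap L) (W.compContinuousLinearMap L)
      (P.compContinuousLinearMap (ContinuousLinearMap.precomp ℝ D)) := by
  refine ⟨fun i b => ?_, fun Z hZ b => ?_⟩
  · rw [sharp_compContinuousLinearMap, compContinuousLinearMap_vec1, hLD]
    exact h.apply_sharp_eq_zero i _
  · rw [sharp_compContinuousLinearMap, ContinuousAlternatingMap.compContinuousLinearMap_apply,
      comp_vecCons, comp_vecCons, Subsingleton.elim (_ ∘ _) ![], hLD, h.apply_eq]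
    · change b (D (L Z)) = b Z
      rw [hDL]
    · intro i
      have h1 := hZ i
      rwa [compContinuousLinearMap_vec1] at h1

end Transport

/-! ### Coordinate expressions at the centre of a chart -/

section Charts

open Filter Topology

variable {m : ℕ} {M : Type*} [TopologicalSpace M] [ChartedSpace (EuclideanSpace ℝ (Fin m)) M]

/-- The derivative at `y` of the inverse of the preferred chart at `x`. -/
def symmL (x : M) (y : EuclideanSpace ℝ (Fin m)) :
    EuclideanSpace ℝ (Fin m) →L[ℝ] TangentSpace (𝓡 m) ((extChartAt (𝓡 m) x).symm y) :=
  mfderiv 𝓘(ℝ, EuclideanSpace ℝ (Fin m)) (𝓡 m) (extChartAt (𝓡 m) x).symm y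

/-- The derivative at `x'` of the preferred chart at `x`. -/
def chartD (x x' : M) : TangentSpace (𝓡 m) x' →L[ℝ] EuclideanSpace ℝ (Fin m) :=
  mfderiv (𝓡 m) 𝓘(ℝ, EuclideanSpace ℝ (Fin m)) (extChartAt (𝓡 m) x) x'

/-- The derivative, at the image of `x'`, of the inverse of the preferred chart at `x`. On the domain
of the chart it is the inverse of `chartD x x'`; it differs from `symmL` in that it takes values in
the tangent space at `x'` itself. -/
def chartL (x x' : M) : EuclideanSpace ℝ (Fin m) →L[ℝ] TangentSpace (𝓡 m) x' :=
  mfderiv 𝓘(ℝ, EuclideanSpace ℝ (Fin m)) (𝓡 m) (extChartAt (𝓡 m) x).symm (extChartAt (𝓡 m) x x')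

/-- All tangent spaces are definitionally the model space; the type ascriptions in the proof remove
the dependence on the base point, so that `φ⁻¹ (φ x') = x'` can be used under the congruence. -/
theorem Form.inChart_apply_chart {n : ℕ} (f : Form m M n) (x : M) {x' : M}
    (hx' : x' ∈ (extChartAt (𝓡 m) x).source) :
    f.inChart x (extChartAt (𝓡 m) x x') = (f x').compContinuousLinearMap (chartL x x') :=
  congrArg (fun z => (show EuclideanSpace ℝ (Fin m) [⋀^Fin n]→L[ℝ] ℝ from f z
    ).compContinuousLinearMap
      (show EuclideanSpace ℝ (Fin m) →L[ℝ] EuclideanSpace ℝ (Fin m) from chartL x x'))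
    ((extChartAt (𝓡 m) x).left_inv hx')

theorem Bivector.inChart_apply_chart (P : Bivector m M) (x : M) {x' : M}
    (hx' : x' ∈ (extChartAt (𝓡 m) x).source) :
    P.inChart x (extChartAt (𝓡 m) x x')
      = (P x').compContinuousLinearMap (ContinuousLinearMap.precomp ℝ (chartD x x')) :=
  congrArg (fun z => (show (EuclideanSpace ℝ (Fin m) →L[ℝ] ℝ) [⋀^Fin 2]→L[ℝ] ℝ from P z
    ).compContinuousLinearMap (ContinuousLinearMap.precomp ℝ
      (show EuclideanSpace ℝ (Fin m) →L[ℝ] EuclideanSpace ℝ (Fin m) from chartD x z)))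
    ((extChartAt (𝓡 m) x).left_inv hx')

theorem Form.d_apply {n : ℕ} (f : Form m M n) (x : M) (v : Fin (n + 1) → TangentSpace (𝓡 m) x) :
    f.d x v = extDeriv (f.inChart x) (extChartAt (𝓡 m) x x) (chartD x x ∘ v) := rfl

theorem Form.Smooth.differentiableAt {n : ℕ} {f : Form m M n} (hf : f.Smooth) (x : M) :
    DifferentiableAt ℝ (f.inChart x) (extChartAt (𝓡 m) x x) :=
  ((hf x).contDiffAt (extChartAt_target_mem_nhds x)).differentiableAt (by simp)

theorem Bivector.Smooth.differentiableAt {P : Bivector m M} (hP : P.Smooth) (x : M) :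
    DifferentiableAt ℝ (P.inChart x) (extChartAt (𝓡 m) x x) :=
  ((hP x).contDiffAt (extChartAt_target_mem_nhds x)).differentiableAt (by simp)

theorem muForm_inChart {k : ℕ} (α : Fin k → Form m M 1) (x : M) (y : EuclideanSpace ℝ (Fin m)) :
    (muForm α).inChart x y = wedgeFamily k fun i => (α i).inChart x y :=
  wedgeFamily_compContinuousLinearMap (symmL x y) _

variable [IsManifold (𝓡 m) ∞ M]

theorem chartD_symmL (x : M) {y : EuclideanSpace ℝ (Fin m)} (hy : y ∈ (extChartAt (𝓡 m) x).target)
    (v : EuclideanSpace ℝ (Fin m)) :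
    chartD x _ (symmL x y v) = v := by
  have h := mfderiv_extChartAt_comp_mfderivWithin_extChartAt_symm (I := 𝓡 m) hy
  rw [ModelWithCorners.range_eq_univ, mfderivWithin_univ] at h
  exact DFunLike.congr_fun h v

theorem symmL_chartD (x : M) {y : EuclideanSpace ℝ (Fin m)} (hy : y ∈ (extChartAt (𝓡 m) x).target)
    (v : TangentSpace (𝓡 m) ((extChartAt (𝓡 m) x).symm y)) :
    symmL x y (chartD x _ v) = v := by
  have h := mfderivWithin_extChartAt_symm_comp_mfderiv_extChartAt (I := 𝓡 m) hy
  rw [ModelWithCorners.range_eq_univ, mfderivWithin_univ] at h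
  exact DFunLike.congr_fun h v

theorem chartL_chartD (x : M) {x' : M} (hx' : x' ∈ (extChartAt (𝓡 m) x).source)
    (v : TangentSpace (𝓡 m) x') : chartL x x' (chartD x x' v) = v := by
  have h := mfderivWithin_extChartAt_symm_comp_mfderiv_extChartAt' (I := 𝓡 m) hx'
  rw [ModelWithCorners.range_eq_univ, mfderivWithin_univ] at h
  exact DFunLike.congr_fun h v

theorem chartD_chartL (x : M) {x' : M} (hx' : x' ∈ (extChartAt (𝓡 m) x).source)
    (v : EuclideanSpace ℝ (Fin m)) : chartD x x' (chartL x x' v) = v := by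
  have h := mfderiv_extChartAt_comp_mfderivWithin_extChartAt_symm' (I := 𝓡 m) hx'
  rw [ModelWithCorners.range_eq_univ, mfderivWithin_univ] at h
  exact DFunLike.congr_fun h v

theorem VField.symmL_inChart (X : VField m M) (x : M) {y : EuclideanSpace ℝ (Fin m)}
    (hy : y ∈ (extChartAt (𝓡 m) x).target) :
    symmL x y (X.inChart x y) = X ((extChartAt (𝓡 m) x).symm y) := by
  have h := isInvertible_mfderivWithin_extChartAt_symm (I := 𝓡 m) hy
  rw [ModelWithCorners.range_eq_univ, mfderivWithin_univ] at h
  exact h.self_apply_inverse _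

theorem VField.inChart_apply (X : VField m M) (x : M) {y : EuclideanSpace ℝ (Fin m)}
    (hy : y ∈ (extChartAt (𝓡 m) x).target) :
    X.inChart x y = chartD x _ (X ((extChartAt (𝓡 m) x).symm y)) := by
  rw [← X.symmL_inChart x hy, chartD_symmL x hy]

theorem VField.inChart_apply_chart (X : VField m M) (x : M) {x' : M}
    (hx' : x' ∈ (extChartAt (𝓡 m) x).source) :
    X.inChart x (extChartAt (𝓡 m) x x') = chartD x x' (X x') := by
  rw [X.inChart_apply x ((extChartAt (𝓡 m) x).map_source hx')]
  exact congrArg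
    (fun z => (show EuclideanSpace ℝ (Fin m) →L[ℝ] EuclideanSpace ℝ (Fin m) from chartD x z) (X z))
    ((extChartAt (𝓡 m) x).left_inv hx')

theorem Form.d_apply_chartL {n : ℕ} (f : Form m M n) (x : M)
    (v : Fin (n + 1) → EuclideanSpace ℝ (Fin m)) :
    f.d x (chartL x x ∘ v) = extDeriv (f.inChart x) (extChartAt (𝓡 m) x x) v := by
  rw [Form.d_apply]
  congr 1
  ext i : 1
  exact chartD_chartL x (mem_extChartAt_source x) (v i)

theorem VField.SmoothOn.differentiableAt {X : VField m M} {U : Set M} (hX : X.SmoothOn U)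
    (hU : IsOpen U) {x : M} (hx : x ∈ U) :
    DifferentiableAt ℝ (X.inChart x) (extChartAt (𝓡 m) x x) := by
  have h1 : MDifferentiableAt (𝓡 m) (𝓡 m).tangent
      (fun x => (⟨x, X x⟩ : TangentBundle (𝓡 m) M)) x :=
    (hX.contMDiffAt (hU.mem_nhds hx)).mdifferentiableAt (by simp)
  have h2 := (mdifferentiableWithinAt_univ.mpr
    h1).differentiableWithinAt_mpullbackWithin_vectorField
  simp only [ModelWithCorners.range_eq_univ, Set.preimage_univ, Set.inter_univ,
    VectorField.mpullbackWithin_univ] at h2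
  exact differentiableWithinAt_univ.mp h2

theorem iprod_inChart {n : ℕ} (X : VField m M) (f : Form m M (n + 1)) (x : M)
    {y : EuclideanSpace ℝ (Fin m)} (hy : y ∈ (extChartAt (𝓡 m) x).target) :
    (Form.iprod X f).inChart x y = interior (X.inChart x y) (f.inChart x y) := by
  ext v
  change f _ (Matrix.vecCons (X _) (symmL x y ∘ v))
    = f _ (symmL x y ∘ Matrix.vecCons (X.inChart x y) v)
  rw [comp_vecCons, X.symmL_inChart x hy]

end Charts

/-! ### The bivector of a compatible 2-form -/

section Compatible

open Filter Topology

variable {m k r : ℕ} {M : Type*} [TopologicalSpace M] [ChartedSpace (EuclideanSpace ℝ (Fin m)) M]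
  {α : Fin k → Form m M 1} {ϖ : Form m M 2} {P : Bivector m M}

theorem finrank_tangentSpace (x : M) : Module.finrank ℝ (TangentSpace (𝓡 m) x) = m :=
  finrank_euclideanSpace_fin

theorem IsInverseOn.range_sharp {x : M}
    (h : IsInverseOn (fun i => α i x) (ϖ x) (P x)) : P.charDist x = tangentDist α x := by
  apply le_antisymm
  · rintro _ ⟨b, rfl⟩ i
    exact h.apply_sharp_eq_zero i b
  · intro Z hZ
    -- A tangent vector `Z` is the image of the covector `- i_Z ϖ`.
    refine ⟨-LinearMap.toContinuousLinearMap (covec (interior Z (ϖ x))), ?_⟩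
    rw [map_neg, ← sub_eq_zero, ← Module.forall_dual_apply_eq_zero_iff ℝ]
    intro c
    have h1 := apply_sharp (P x) (LinearMap.toContinuousLinearMap (covec (interior Z (ϖ x))))
      (LinearMap.toContinuousLinearMap c)
    rw [bivector_swap, ← apply_sharp] at h1
    have h2 : (LinearMap.toContinuousLinearMap (covec (interior Z (ϖ x))))
        (sharp (P x) (LinearMap.toContinuousLinearMap c)) = c Z :=
      h.apply_eq Z hZ (LinearMap.toContinuousLinearMap c)
    rw [h2] at h1
    change c (sharp (P x) (LinearMap.toContinuousLinearMap (covec (interior Z (ϖ x)))))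
      = -c Z at h1
    rw [map_sub, map_neg, h1, neg_neg, sub_self]

theorem covec_sum_smul {X : Fin k → VField m M} (x : M)
    (h : ∀ i j, α i x ![X j x] = if i = j then 1 else 0) (c : Fin k → ℝ) (i : Fin k) :
    covec (α i x) (∑ j, c j • X j x) = c i := by
  simp [map_sum, covec_apply, h]

/-- Every `v` is the sum of `∑ j, α_j(v) X^j` and of a vector tangent to the foliation. -/
theorem isCompl_span_tangentDist {X : Fin k → VField m M} (x : M)
    (h : ∀ i j, α i x ![X j x] = if i = j then 1 else 0) :
    IsCompl (Submodule.span ℝ (Set.range fun j => X j x)) (tangentDist α x) := by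
  rw [isCompl_iff, disjoint_iff_inf_le, codisjoint_iff_le_sup]
  constructor
  · rintro v ⟨hv, hv'⟩
    obtain ⟨c, rfl⟩ := (Submodule.mem_span_range_iff_exists_fun ℝ).mp hv
    have hc : c = 0 := funext fun i => by
      rw [← covec_sum_smul x h c i]
      exact hv' i
    simp [hc]
  · intro v _
    refine Submodule.mem_sup.mpr ⟨∑ j, α j x ![v] • X j x, ?_, v - ∑ j, α j x ![v] • X j x, ?_,
      add_sub_cancel _ _⟩
    · exact Submodule.sum_mem _ fun j _ =>
        Submodule.smul_mem _ _ (Submodule.subset_span ⟨j, rfl⟩)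
    · intro i
      rw [← covec_apply, map_sub, covec_sum_smul x h, covec_apply, sub_self]

theorem linearIndependent_of_dual {X : Fin k → VField m M} (x : M)
    (h : ∀ i j, α i x ![X j x] = if i = j then 1 else 0) :
    LinearIndependent ℝ fun j => X j x := by
  rw [Fintype.linearIndependent_iff]
  intro c hc i
  rw [← covec_sum_smul x h c i, hc, map_zero]

theorem finrank_tangentDist {X : Fin k → VField m M} (x : M)
    (h : ∀ i j, α i x ![X j x] = if i = j then 1 else 0) :
    Module.finrank ℝ (tangentDist α x) = m - k := by
  have h1 := Submodule.finrank_add_eq_of_isCompl (isCompl_span_tangentDist x h)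
  rw [finrank_span_eq_card (linearIndependent_of_dual x h), Fintype.card_fin,
    finrank_tangentSpace] at h1
  omega

/-- Tangency to the foliation, read in the chart at `x`. -/
theorem inChart_apply_eq_zero_iff (x : M) (u : EuclideanSpace ℝ (Fin m)) (i : Fin k) :
    (α i).inChart x (extChartAt (𝓡 m) x x) ![u] = 0 ↔ α i x ![chartL x x u] = 0 := by
  rw [Form.inChart_apply_chart _ _ (mem_extChartAt_source x), compContinuousLinearMap_vec1]

theorem IsCompatible.muForm_ne_zero (hϖ : IsCompatible r α ϖ) (x : M) : muForm α x ≠ 0 := by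
  intro h
  refine hϖ.volume x ?_
  rw [volForm, h, wedge_zero_left]

theorem IsCompatible.isInverseOn (hϖ : IsCompatible r α ϖ)
    (hPϖ : ∀ x, contract (P x) (volForm r α ϖ x) = sigmaForm r α ϖ x) (x : M) :
    IsInverseOn (fun i => α i x) (ϖ x) (P x) := by
  have hk := (finrank_tangentSpace x).trans hϖ.dim_eq
  cases r with
  | zero => exact isInverseOn_of_contract_zero _ _ _ hk (hϖ.volume x) (hPϖ x)
  | succ r => exact isInverseOn_of_contract_eq _ _ _ hk (hϖ.volume x) (hPϖ x)

theorem IsCompatible.charDist_eq (hϖ : IsCompatible r α ϖ)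
    (hPϖ : ∀ x, contract (P x) (volForm r α ϖ x) = sigmaForm r α ϖ x) (x : M) :
    P.charDist x = tangentDist α x :=
  (hϖ.isInverseOn hPϖ x).range_sharp

variable [IsManifold (𝓡 m) ∞ M]

theorem isInverseOn_inChart (h : ∀ x, IsInverseOn (fun i => α i x) (ϖ x) (P x)) (x : M)
    {y : EuclideanSpace ℝ (Fin m)} (hy : y ∈ (extChartAt (𝓡 m) x).target) :
    IsInverseOn (fun i => (α i).inChart x y) (ϖ.inChart x y) (P.inChart x y) :=
  (h ((extChartAt (𝓡 m) x).symm y)).transport (symmL x y) (chartD x _)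
    (chartD_symmL x hy) (symmL_chartD x hy)

/-- If `df ∧ μ = 0`, then `f` is closed along the leaves; both sides are read at the centre of a
chart. -/
theorem extDeriv_inChart_eq_zero {n : ℕ} {f : Form m M n} {x : M} (hμ : muForm α x ≠ 0)
    (h : wedge (f.d x) (muForm α x) = 0) (u : Fin (n + 1) → EuclideanSpace ℝ (Fin m))
    (hu : ∀ j i, (α i).inChart x (extChartAt (𝓡 m) x x) ![u j] = 0) :
    extDeriv (f.inChart x) (extChartAt (𝓡 m) x x) u = 0 := by
  rw [← Form.d_apply_chartL]
  exact apply_eq_zero_of_wedge_wedgeFamily _ _ hμ h _ fun j i =>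
    (inChart_apply_eq_zero_iff x _ i).mp (hu j i)

theorem IsCompatible.isInverseNear (hα : IsGenerators α) (hϖ : IsCompatible r α ϖ)
    (hP : P.Smooth) (hPϖ : ∀ x, contract (P x) (volForm r α ϖ x) = sigmaForm r α ϖ x) (x : M) :
    IsInverseNear (fun i => (α i).inChart x) (ϖ.inChart x) (P.inChart x)
      (extChartAt (𝓡 m) x x) where
  diff_A i := (hα.smooth i).differentiableAt x
  diff_W := hϖ.smooth.differentiableAt x
  diff_P := hP.differentiableAt x
  inverse := by
    filter_upwards [extChartAt_target_mem_nhds (I := 𝓡 m) x] with y hy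
    exact isInverseOn_inChart (hϖ.isInverseOn hPϖ) x hy
  extDeriv_A u v hu hv i :=
    extDeriv_inChart_eq_zero (hϖ.muForm_ne_zero x) (hα.integrable i x) _
      (Fin.forall_fin_two.mpr ⟨hu, hv⟩)

theorem IsCompatible.isRegularPoisson (hα : IsGenerators α) (hϖ : IsCompatible r α ϖ)
    (hP : P.Smooth) (hPϖ : ∀ x, contract (P x) (volForm r α ϖ x) = sigmaForm r α ϖ x)
    {X : Fin k → VField m M} (hX : IsDual α X) : P.IsRegularPoisson where
  smooth := hP
  jacobi x := (hϖ.isInverseNear hα hP hPϖ x).schoutenSelf_eq_zero fun u v w hu hv hw =>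
    extDeriv_inChart_eq_zero (hϖ.muForm_ne_zero x) (hϖ.closed x) _
      (by
        intro j
        fin_cases j
        · exact hu
        · exact hv
        · exact hw)
  rank_const := ⟨m - k, fun x => by
    rw [hϖ.charDist_eq hPϖ, finrank_tangentDist x fun i j => hX.apply_eq i j x]⟩

end Compatible

/-! ### Poisson vector fields -/

section PoissonFields

open Filter Topology

theorem contDiffOn_sharp {E : Type*} [NormedAddCommGroup E] [NormedSpace ℝ E]
    [FiniteDimensional ℝ E] {n : WithTop ℕ∞} {P : E → (E →L[ℝ] ℝ) [⋀^Fin 2]→L[ℝ] ℝ} {s : Set E}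
    (hP : ContDiffOn ℝ n P s) (a : E →L[ℝ] ℝ) : ContDiffOn ℝ n (fun z => sharp (P z) a) s := by
  change ContDiffOn ℝ n (fun z => ∑ i, P z ![a, coframe E i] • Module.finBasis ℝ E i) s
  refine ContDiffOn.sum fun i _ => ContDiffOn.smul ?_ contDiffOn_const
  exact (ContinuousAlternatingMap.apply ℝ (E →L[ℝ] ℝ) ℝ ![a, coframe E i]).contDiff.comp_contDiffOn
    hP

variable {m k r : ℕ} {M : Type*} [TopologicalSpace M] [ChartedSpace (EuclideanSpace ℝ (Fin m)) M]
  {α : Fin k → Form m M 1} {ϖ : Form m M 2} {P : Bivector m M}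

theorem sharp_inChart (P : Bivector m M) (x : M) {x' : M} (hx' : x' ∈ (extChartAt (𝓡 m) x).source)
    (a : EuclideanSpace ℝ (Fin m) →L[ℝ] ℝ) :
    sharp (P.inChart x (extChartAt (𝓡 m) x x')) a
      = chartD x x' (sharp (P x') (a ∘L chartD x x')) := by
  rw [Bivector.inChart_apply_chart _ _ hx', sharp_compContinuousLinearMap]

theorem wedgeFamily_inChart_ne_zero [IsManifold (𝓡 m) ∞ M] {x : M} (hμ : muForm α x ≠ 0) :
    (wedgeFamily k fun i => (α i).inChart x (extChartAt (𝓡 m) x x)) ≠ 0 := by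
  rw [← muForm_inChart, Form.inChart_apply_chart _ _ (mem_extChartAt_source x)]
  intro h
  apply hμ
  ext v
  have h1 := DFunLike.congr_fun h (chartD x x ∘ v)
  rw [ContinuousAlternatingMap.compContinuousLinearMap_apply] at h1
  have h2 : (chartL x x ∘ chartD x x ∘ v : Fin k → TangentSpace (𝓡 m) x) = v := by
    ext i : 1
    exact chartL_chartD x (mem_extChartAt_source x) (v i)
  rw [h2] at h1
  exact h1

variable [IsManifold (𝓡 m) ∞ M]

/-- Every covector at a point is the differential of a globally defined smooth function. -/
theorem exists_contMDiff_mfderiv_eq [T2Space M] (x : M) (a : EuclideanSpace ℝ (Fin m) →L[ℝ] ℝ) :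
    ∃ f : M → ℝ, ContMDiff (𝓡 m) 𝓘(ℝ, ℝ) ∞ f ∧
      mfderiv (𝓡 m) 𝓘(ℝ, ℝ) f x = a ∘L chartD x x := by
  obtain ⟨β⟩ : Nonempty (SmoothBumpFunction (𝓡 m) x) := inferInstance
  refine ⟨fun z => β z • a (extChartAt (𝓡 m) x z), β.contMDiff_smul ?_, ?_⟩
  · exact a.contDiff.contMDiff.comp_contMDiffOn contMDiffOn_extChartAt
  · have h : (fun z => β z • a (extChartAt (𝓡 m) x z)) =ᶠ[𝓝 x] a ∘ extChartAt (𝓡 m) x := by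
      filter_upwards [β.eventuallyEq_one] with z hz
      simp [hz]
    rw [h.mfderiv_eq, mfderiv_comp x a.differentiableAt.mdifferentiableAt
      (mdifferentiableAt_extChartAt (mem_chart_source _ x)), mfderiv_eq_fderiv, a.fderiv]
    rfl

/-- A vector field annihilating `ϖ` and preserving the foliation is a Poisson vector field, as soon
as `dϖ (X, ·, ·)` vanishes along the leaves. -/
theorem schoutenVec_inChart_eq_zero {x : M}
    (h : IsInverseNear (fun i => (α i).inChart x) (ϖ.inChart x) (P.inChart x)
      (extChartAt (𝓡 m) x x))
    {X : VField m M} {U : Set M} (hU : IsOpen U) (hx : x ∈ U) (hX : X.SmoothOn U)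
    (hXϖ : ∀ z ∈ U, interior (X z) (ϖ z) = 0)
    (hdϖ : ∀ u v, (∀ i, α i x ![u] = 0) → (∀ i, α i x ![v] = 0) → ϖ.d x ![X x, u, v] = 0)
    (hXA : ∀ (a : EuclideanSpace ℝ (Fin m) →L[ℝ] ℝ) (i : Fin k),
      (α i).inChart x (extChartAt (𝓡 m) x x)
        ![fderiv ℝ (fun z => sharp (P.inChart x z) a) (extChartAt (𝓡 m) x x)
            (X.inChart x (extChartAt (𝓡 m) x x))
          - fderiv ℝ (X.inChart x) (extChartAt (𝓡 m) x x)
            (sharp (P.inChart x (extChartAt (𝓡 m) x x)) a)] = 0)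
    (a b : EuclideanSpace ℝ (Fin m) →L[ℝ] ℝ) :
    schoutenVec (X.inChart x) (P.inChart x) (extChartAt (𝓡 m) x x) a b = 0 := by
  refine h.schoutenVec_eq_zero (hX.differentiableAt hU hx) ?_ ?_ hXA a b
  · have hc : ∀ᶠ z in 𝓝 (extChartAt (𝓡 m) x x), (extChartAt (𝓡 m) x).symm z ∈ U := by
      refine (continuousAt_extChartAt_symm x).preimage_mem_nhds (hU.mem_nhds ?_)
      rwa [extChartAt_to_inv]
    filter_upwards [extChartAt_target_mem_nhds (I := 𝓡 m) x, hc] with z hz hzU v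
    change ϖ _ (symmL x z ∘ ![X.inChart x z, v]) = 0
    rw [comp_vecCons, X.symmL_inChart x hz]
    exact DFunLike.congr_fun (hXϖ _ hzU) (symmL x z ∘ ![v])
  · intro u v hu hv
    rw [← Form.d_apply_chartL, comp_vecCons, comp_vecCons, comp_vecCons,
      Subsingleton.elim (_ ∘ _) ![], X.inChart_apply_chart x (mem_extChartAt_source x),
      chartL_chartD x (mem_extChartAt_source x)]
    exact hdϖ _ _ (fun i => (inChart_apply_eq_zero_iff x _ i).mp (hu i))
      (fun i => (inChart_apply_eq_zero_iff x _ i).mp (hv i))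

/-- If all Hamiltonian vector fields annihilate `L_X μ`, then the brackets of `X` with the fields
`P^♯ a`, for constant covectors `a` in the chart at `x`, are tangent to the foliation at `x`. -/
theorem bracket_tangent_of_lieDeriv [T2Space M] {x : M}
    (h : IsInverseNear (fun i => (α i).inChart x) (ϖ.inChart x) (P.inChart x)
      (extChartAt (𝓡 m) x x)) (hμ : muForm α x ≠ 0)
    {X : VField m M} (hX : DifferentiableAt ℝ (X.inChart x) (extChartAt (𝓡 m) x x))
    (hL : ∀ f : M → ℝ, ContMDiff (𝓡 m) 𝓘(ℝ, ℝ) ∞ f →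
      interior (P.hamiltonian f x) ((muForm α).lieDeriv X x) = 0)
    (a : EuclideanSpace ℝ (Fin m) →L[ℝ] ℝ) (i : Fin k) :
    (α i).inChart x (extChartAt (𝓡 m) x x)
      ![fderiv ℝ (fun z => sharp (P.inChart x z) a) (extChartAt (𝓡 m) x x)
          (X.inChart x (extChartAt (𝓡 m) x x))
        - fderiv ℝ (X.inChart x) (extChartAt (𝓡 m) x x)
          (sharp (P.inChart x (extChartAt (𝓡 m) x x)) a)] = 0 := by
  cases k with
  | zero => exact i.elim0
  | succ k =>
    have hs := mem_extChartAt_source (I := 𝓡 m) x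
    refine h.bracket_tangent hX (wedgeFamily_inChart_ne_zero hμ) a (fun w => ?_) i
    obtain ⟨f, hf, hfa⟩ := exists_contMDiff_mfderiv_eq x a
    have h1 := DFunLike.congr_fun (hL f hf) (chartL x x ∘ w)
    have hham : P.hamiltonian f x
        = chartL x x (sharp (P.inChart x (extChartAt (𝓡 m) x x)) a) := by
      rw [sharp_inChart P x hs, chartL_chartD x hs, ← hfa]
      rfl
    have hXx : X x = chartL x x (X.inChart x (extChartAt (𝓡 m) x x)) := by
      rw [X.inChart_apply_chart x hs, chartL_chartD x hs]
    change (Form.iprod X (muForm α)).d x (Matrix.vecCons (P.hamiltonian f x) (chartL x x ∘ w))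
      + (muForm α).d x (Matrix.vecCons (X x)
        (Matrix.vecCons (P.hamiltonian f x) (chartL x x ∘ w))) = 0 at h1
    rw [hham, hXx, ← comp_vecCons, ← comp_vecCons, Form.d_apply_chartL, Form.d_apply_chartL] at h1
    have e1 : (Form.iprod X (muForm α)).inChart x =ᶠ[𝓝 (extChartAt (𝓡 m) x x)] fun z =>
        interior (X.inChart x z) (wedgeFamily (k + 1) fun i => (α i).inChart x z) := by
      filter_upwards [extChartAt_target_mem_nhds (I := 𝓡 m) x] with z hz
      rw [iprod_inChart X _ x hz, muForm_inChart]
    rw [e1.extDeriv_eq, funext (muForm_inChart α x)] at h1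
    exact h1

/-- If `X` preserves the foliation, then its brackets with the fields `P^♯ a`, for constant
covectors `a` in the chart at `x`, are tangent to the foliation at `x`. -/
theorem bracket_tangent_of_preservesOn (hP : P.Smooth)
    (hD : ∀ z, P.charDist z = tangentDist α z) {X : VField m M} {U : Set M} (hU : IsOpen U)
    (hX : PreservesOn P.charDist X U) {x : M} (hx : x ∈ U)
    (a : EuclideanSpace ℝ (Fin m) →L[ℝ] ℝ) (i : Fin k) :
    (α i).inChart x (extChartAt (𝓡 m) x x)
      ![fderiv ℝ (fun z => sharp (P.inChart x z) a) (extChartAt (𝓡 m) x x)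
          (X.inChart x (extChartAt (𝓡 m) x x))
        - fderiv ℝ (X.inChart x) (extChartAt (𝓡 m) x x)
          (sharp (P.inChart x (extChartAt (𝓡 m) x x)) a)] = 0 := by
  have hinv : ∀ x' ∈ (extChartAt (𝓡 m) x).source,
      (chartD x x').inverse = chartL x x' := fun x' hx' =>
    ContinuousLinearMap.inverse_eq
      (ContinuousLinearMap.ext fun v => chartD_chartL x hx' v)
      (ContinuousLinearMap.ext fun v => chartL_chartD x hx' v)
  -- The vector field `P^♯ a` on the domain of the chart.
  let Y : VField m M := VectorField.mpullback (𝓡 m) 𝓘(ℝ, EuclideanSpace ℝ (Fin m))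
    (extChartAt (𝓡 m) x) fun z => sharp (P.inChart x z) a
  have hY : ∀ x' ∈ (extChartAt (𝓡 m) x).source, Y x' = sharp (P x') (a ∘L chartD x x') := by
    intro x' hx'
    change (chartD x x').inverse (sharp (P.inChart x (extChartAt (𝓡 m) x x')) a) = _
    rw [hinv x' hx', sharp_inChart P x hx', chartL_chartD x hx']
  have hYc : Y.inChart x =ᶠ[𝓝 (extChartAt (𝓡 m) x x)] fun z => sharp (P.inChart x z) a := by
    filter_upwards [extChartAt_target_mem_nhds (I := 𝓡 m) x] with z hz
    have hz' := (extChartAt (𝓡 m) x).map_target hz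
    rw [Y.inChart_apply x hz, hY _ hz', ← sharp_inChart P x hz', (extChartAt (𝓡 m) x).right_inv hz]
  have hsmooth : Y.SmoothOn (U ∩ (extChartAt (𝓡 m) x).source) := by
    intro x' hx'
    refine ContMDiffAt.contMDiffWithinAt ?_
    refine ContMDiffAt.mpullback_vectorField_preimage (n := ∞) ?_
      (contMDiffAt_extChartAt' (by simpa using hx'.2)) (isInvertible_mfderiv_extChartAt hx'.2)
      (by simp)
    exact contMDiffAt_vectorSpace_iff_contDiffAt.mpr ((contDiffOn_sharp (hP x) a).contDiffAt
      ((isOpen_extChartAt_target x).mem_nhds ((extChartAt (𝓡 m) x).map_source hx'.2)))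
  have hbr := hX _ Y (hU.inter (isOpen_extChartAt_source x)) Set.inter_subset_left hsmooth
    (fun x' hx' => by rw [hY x' hx'.2]; exact ⟨_, rfl⟩) x ⟨hx, mem_extChartAt_source x⟩
  rw [hD, ← VectorField.mlieBracketWithin_univ, VectorField.mlieBracketWithin_apply] at hbr
  simp only [ModelWithCorners.range_eq_univ, Set.preimage_univ, Set.inter_univ,
    VectorField.mpullbackWithin_univ] at hbr
  have hbr' : (chartD x x).inverse (VectorField.lieBracketWithin ℝ (X.inChart x) (Y.inChart x)
      Set.univ (extChartAt (𝓡 m) x x)) ∈ tangentDist α x := hbr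
  rw [VectorField.lieBracketWithin_univ, VectorField.lieBracket_eq,
    hinv x (mem_extChartAt_source x)] at hbr'
  beta_reduce at hbr'
  rw [hYc.fderiv_eq, hYc.self_of_nhds] at hbr'
  exact (inChart_apply_eq_zero_iff x _ i).mpr (hbr' i)

end PoissonFields

end FoliatedPoisson

end

theorem mainTheorem3 {m k r : ℕ} {M : Type*} [TopologicalSpace M] [T2Space M]
    [SecondCountableTopology M] [ChartedSpace (EuclideanSpace ℝ (Fin m)) M]
    [IsManifold (𝓡 m) ∞ M]
    (α : Fin k → FoliatedPoisson.Form m M 1) (hα : FoliatedPoisson.IsGenerators α)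
    (ϖ : FoliatedPoisson.Form m M 2) (hϖ : FoliatedPoisson.IsCompatible r α ϖ)
    (X : Fin k → FoliatedPoisson.VField m M) (hX : FoliatedPoisson.IsDual α X)
    (hXϖ : ∀ j x, FoliatedPoisson.interior (X j x) (ϖ x) = 0)
    (P : FoliatedPoisson.Bivector m M) (hP : P.Smooth)
    (hPϖ : ∀ x, FoliatedPoisson.contract (P x) (FoliatedPoisson.volForm r α ϖ x)
      = FoliatedPoisson.sigmaForm r α ϖ x)
    (ha : ∀ (j : Fin k) (f : M → ℝ), ContMDiff (𝓡 m) 𝓘(ℝ, ℝ) ∞ f → ∀ x,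
      FoliatedPoisson.interior (P.hamiltonian f x)
        ((FoliatedPoisson.muForm α).lieDeriv (X j) x) = 0)
    (hb : ∀ (j : Fin k) (x : M),
      FoliatedPoisson.wedge
        (FoliatedPoisson.interior (X j x) (FoliatedPoisson.muForm α x)) (ϖ.d x) = 0) :
    (P.IsRegularPoisson ∧ ∀ x, P.charDist x = FoliatedPoisson.tangentDist α x) ∧
      (∀ j, P.IsPoissonVFieldOn (X j) Set.univ) ∧
      P.IsTransversallyConstant := by
  have hreg := hϖ.isRegularPoisson hα hP hPϖ hX
  have hD := hϖ.charDist_eq hPϖ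
  have hnear := hϖ.isInverseNear hα hP hPϖ
  have hdϖ : ∀ j x u v, (∀ i, α i x ![u] = 0) → (∀ i, α i x ![v] = 0) →
      ϖ.d x ![X j x, u, v] = 0 := by
    intro j x u v hu hv
    refine FoliatedPoisson.apply_eq_zero_of_interior_wedge _ (fun i => α i x)
      (hϖ.muForm_ne_zero x) (X j x) j (by simp [hX.apply_eq]) (hb j x) _ fun l => ?_
    fin_cases l
    · exact Or.inl rfl
    · exact Or.inr hu
    · exact Or.inr hv
  refine ⟨⟨hreg, hD⟩, fun j x _ => ?_, hreg,
    fun x => Submodule.span ℝ (Set.range fun j => X j x), fun x₀ => ?_, fun x => ?_,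
    fun U Y hU hY hYT hYP x hx => ?_⟩
  · exact FoliatedPoisson.schoutenVec_inChart_eq_zero (hnear x) isOpen_univ (Set.mem_univ x)
      (hX.smooth j) (fun z _ => hXϖ j z) (hdϖ j x)
      (FoliatedPoisson.bracket_tangent_of_lieDeriv (hnear x) (hϖ.muForm_ne_zero x)
        ((hX.smooth j).differentiableAt isOpen_univ (Set.mem_univ x)) fun f hf => ha j f hf x)
  · exact ⟨Set.univ, k, X, isOpen_univ, Set.mem_univ x₀, hX.smooth, fun _ _ => rfl⟩
  · rw [hD x]
    exact FoliatedPoisson.isCompl_span_tangentDist x fun i j => hX.apply_eq i j x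
  · refine FoliatedPoisson.schoutenVec_inChart_eq_zero (hnear x) hU hx hY (fun z hz => ?_)
      (fun u v hu hv => ?_) (FoliatedPoisson.bracket_tangent_of_preservesOn hP hD hU hYP hx)
    -- Both conditions hold for the `X^j` and are linear in the value of the field at the point.
    · ext w
      have hz' := hYT z hz
      generalize Y z = y at hz' ⊢
      induction hz' using Submodule.span_induction with
      | mem y hy =>
        obtain ⟨j, rfl⟩ := hy
        exact DFunLike.congr_fun (hXϖ j z) w
      | zero => exact (ϖ z).map_coord_zero 0 rfl
      | add y y' _ _ h h' =>
        exact ((ϖ z).vecCons_add w y y').trans (by rw [← add_zero 0]; exact congrArg₂ _ h h')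
      | smul c y _ h =>
        exact ((ϖ z).vecCons_smul w c y).trans (by rw [← smul_zero c]; exact congrArg _ h)
    · have hx' := hYT x hx
      generalize Y x = y at hx' ⊢
      induction hx' using Submodule.span_induction with
      | mem y hy =>
        obtain ⟨j, rfl⟩ := hy
        exact hdϖ j x u v hu hv
      | zero => exact (ϖ.d x).map_coord_zero 0 rfl
      | add y y' _ _ h h' => rw [ContinuousAlternatingMap.vecCons_add, h, h', add_zero]
      | smul c y _ h => rw [ContinuousAlternatingMap.vecCons_smul, h, smul_zero]
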